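/- For a metric space $X$ and a real number $d>0$, the $d$-chromatic number $\chi(X,d)\in\mathbb N\cup\{\infty\}$ is the minimal number of colors needed to color all points of $X$ so that any two points at distance exactly $d$ are colored differently. A hyperbolic surface is a connected surface that carries its intrinsic (length) distance and is locally isometric to the hyperbolic plane $\mathbb H$ (of curvature $-1$); it is complete if it is geodesically complete, that is, every geodesic extends to a geodesic defined on all of $\mathbb R$. Theorem. There exists a constant $C_1>0$ such that for every real number $d>0$ and every complete hyperbolic surface $S$, $$\chi(S,d)\le C_1\,e^{d}.$$ In particular $\chi(S,d)$ is finite. -/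

import Mathlib

universe u

/-- The `d`-distance graph of a metric space: the vertices are the points, and two (distinct)
points are adjacent when they are exactly at distance `d`. -/
def distanceGraph (X : Type u) [MetricSpace X] (d : ℝ) : SimpleGraph X where
  Adj x y := x ≠ y ∧ dist x y = d
  symm := ⟨fun x y h => ⟨h.1.symm, by rw [dist_comm]; exact h.2⟩⟩
  loopless := ⟨fun _ h => h.1 rfl⟩

/-- The `d`-chromatic number `χ(X, d)` of a metric space: the minimal number of colors needed to
color all points so that points at distance exactly `d` get different colors
(`⊤` if no finite number of colors is enough). -/
noncomputable def dChromaticNumber (X : Type u) [MetricSpace X] (d : ℝ) : ℕ∞ :=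
  (distanceGraph X d).chromaticNumber

/-- The length of a continuous path in a metric space (supremum over subdivisions). -/
noncomputable def pathLength {X : Type u} [MetricSpace X] {x y : X} (γ : Path x y) : ENNReal :=
  eVariationOn γ Set.univ

/-- A hyperbolic surface: a connected space whose distance is the intrinsic one, that is, the
infimum of the lengths of the paths joining two points (as for the Riemannian distance of a
connected Riemannian manifold), and which is locally isometric to the hyperbolic plane: every point
has an open neighbourhood isometric to an open subset of `ℍ`. The metric of `ℍ` is Mathlib's
Poincaré distance on the upper half plane, of constant curvature `-1`. -/
structure IsHyperbolicSurface (S : Type u) [MetricSpace S] : Prop where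
  connected : ConnectedSpace S
  edist_eq_iInf_pathLength : ∀ x y : S, edist x y = ⨅ γ : Path x y, pathLength γ
  locally_isometric : ∀ x : S, ∃ U : Set S, IsOpen U ∧ x ∈ U ∧
    ∃ V : Set UpperHalfPlane, IsOpen V ∧ Nonempty (U ≃ᵢ V)

/-- `c` is a unit-speed geodesic on the set `I` of times: around each time of `I` the curve is
distance-realizing. On a Riemannian manifold and for an interval `I`, these are exactly the
unit-speed Riemannian geodesics. -/
def IsUnitSpeedGeodesicOn {X : Type u} [MetricSpace X] (c : ℝ → X) (I : Set ℝ) : Prop :=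
  ∀ t ∈ I, ∃ ε > 0, ∀ s ∈ I, ∀ s' ∈ I, |s - t| < ε → |s' - t| < ε →
    dist (c s) (c s') = |s - s'|

/-- Geodesic completeness: every geodesic defined on a bounded open interval extends to a geodesic
defined for all times. -/
def GeodesicallyComplete (X : Type u) [MetricSpace X] : Prop :=
  ∀ (a b : ℝ) (c : ℝ → X), a < b → IsUnitSpeedGeodesicOn c (Set.Ioo a b) →
    ∃ c' : ℝ → X, IsUnitSpeedGeodesicOn c' Set.univ ∧ Set.EqOn c' c (Set.Ioo a b)

/-! Put ε = `min d 1 / 4` and choose a maximal ε-separated set in S. Colour each point of S by a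
colour of a nearby net point: points at distance d have distinct net points at mutual distance less
than d + 3ε, so it suffices to colour the proximity graph of the net. Greedy colouring
(`colorable_of_neighbors_le`) does this with one colour more than the maximal number of neighbours,
so only a packing bound for balls of S is needed.

The packing bound is pulled back to ℍ. Completeness gives a local isometry p : ℍ → S through any
prescribed point (`exists_developing_map`). It does not increase distances (`dist_map_le`), and
short paths lift (`exists_lift_of_dist_lt`), so a separated set in a ball of S lifts to an equally
separated set in a ball of ℍ of the same radius. There areas decide: large balls have area O(e^R),
and for small d both relevant areas are of order d², so their ratio stays bounded.

The map p comes from continuing a chart germ, first along one geodesic of ℍ and then along all its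
perpendiculars. Fermi coordinates reach each point of ℍ by a chosen route, so no monodromy argument
is needed. Rigidity drives the continuation: isometries of ℍ with a common germ coincide, and a
distance-preserving map of a ball extends to ℍ. Both become linear algebra in the hyperboloid model.
-/

namespace HyperbolicSurface

open UpperHalfPlane Metric Set Filter Topology MeasureTheory

/-! ### Hyperboloid model and geodesics of ℍ -/

/-- The Lorentzian form on `ℝ³` whose unit pseudosphere contains the hyperboloid model. -/
noncomputable def lorentz (u v : Fin 3 → ℝ) : ℝ := (u 0 * v 1 + u 1 * v 0) / 2 - u 2 * v 2

/-- The hyperboloid model of the upper half plane. -/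
noncomputable def toHyp (z : ℍ) : Fin 3 → ℝ :=
  ![(z.re ^ 2 + z.im ^ 2) / z.im, 1 / z.im, z.re / z.im]

lemma eq_of_cosh_eq {x y : ℝ} (hx : 0 ≤ x) (hy : 0 ≤ y) (h : Real.cosh x = Real.cosh y) :
    x = y := by
  have h1 := Real.cosh_le_cosh.1 h.le
  have h2 := Real.cosh_le_cosh.1 h.ge
  rw [abs_of_nonneg hx, abs_of_nonneg hy] at h1 h2
  exact le_antisymm h1 h2

lemma lorentz_comm (u v : Fin 3 → ℝ) : lorentz u v = lorentz v u := by
  simp only [lorentz]; ring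

lemma cosh_dist_eq_lorentz (z w : ℍ) : Real.cosh (dist z w) = lorentz (toHyp z) (toHyp w) := by
  have hz := z.im_pos
  have hw := w.im_pos
  rw [cosh_dist, Complex.dist_eq, ← Complex.normSq_eq_norm_sq, Complex.normSq_apply]
  simp [lorentz, toHyp]
  field_simp
  ring

lemma lorentz_self (z : ℍ) : lorentz (toHyp z) (toHyp z) = 1 := by
  rw [← cosh_dist_eq_lorentz, dist_self, Real.cosh_zero]

lemma toHyp_injective : Function.Injective toHyp := by
  intro z w h
  have : Real.cosh (dist z w) = 1 := by
    rw [cosh_dist_eq_lorentz, h, lorentz_self]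
  exact dist_eq_zero.1 (eq_of_cosh_eq dist_nonneg le_rfl (this.trans Real.cosh_zero.symm))

lemma dist_eq_of_lorentz_eq {z w z' w' : ℍ}
    (h : lorentz (toHyp z) (toHyp w) = lorentz (toHyp z') (toHyp w')) : dist z w = dist z' w' := by
  rw [← cosh_dist_eq_lorentz, ← cosh_dist_eq_lorentz] at h
  exact eq_of_cosh_eq dist_nonneg dist_nonneg h

/-- The pseudosphere has two sheets. By the reversed Cauchy–Schwarz inequality, two of its vectors
pair positively only on the same sheet, so `h2` selects the sheet parametrized by `toHyp`. -/
lemma exists_toHyp_eq {X : Fin 3 → ℝ} (h1 : lorentz X X = 1) (v : ℍ)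
    (h2 : 0 < lorentz X (toHyp v)) : ∃ z, toHyp z = X := by
  have hv := lorentz_self v
  have hv1 : 0 < toHyp v 1 := by simp [toHyp, v.im_pos]
  have hv0 : 0 < toHyp v 0 := by
    have := v.im_pos
    simp only [toHyp, Matrix.cons_val_zero]
    positivity
  generalize toHyp v = V at *
  simp only [lorentz] at *
  have hX : X 0 * X 1 = 1 + X 2 ^ 2 := by linarith
  have hV : V 0 * V 1 = 1 + V 2 ^ 2 := by linarith
  have hpos : 0 < X 1 := by
    by_contra hneg
    have hX1 : X 1 < 0 := lt_of_le_of_ne (not_lt.1 hneg) (by rintro h; rw [h] at hX; nlinarith)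
    have hX0 : X 0 < 0 := by nlinarith
    have hs : X 0 * V 1 + X 1 * V 0 < 0 := by nlinarith
    have h3 : 4 * (X 2 * V 2) ^ 2 < (X 0 * V 1 + X 1 * V 0) ^ 2 := by
      have : (X 0 * V 1 + X 1 * V 0) ^ 2 - 4 * ((X 0 * X 1) * (V 0 * V 1)) ≥ 0 := by
        nlinarith [sq_nonneg (X 0 * V 1 - X 1 * V 0)]
      rw [hX, hV] at this
      nlinarith [sq_nonneg (X 2), sq_nonneg (V 2)]
    nlinarith
  refine ⟨⟨⟨X 2 / X 1, 1 / X 1⟩, by simpa using hpos⟩, ?_⟩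
  ext i
  fin_cases i
  · simp [toHyp, UpperHalfPlane.re, UpperHalfPlane.im]
    field_simp
    linarith
  · simp [toHyp, UpperHalfPlane.im]
  · simp [toHyp, UpperHalfPlane.re, UpperHalfPlane.im]
    field_simp

/-- The form has signature (1,2), so it is negative definite on the orthogonal complement of a
timelike vector. -/
lemma eq_zero_of_lorentz_eq_zero {w : Fin 3 → ℝ} (h1 : lorentz w w = 0) (v : ℍ)
    (h2 : lorentz w (toHyp v) = 0) : w = 0 := by
  have hv := lorentz_self v
  have hv1 : 0 < toHyp v 1 := by simp [toHyp, v.im_pos]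
  generalize toHyp v = V at *
  simp only [lorentz] at *
  have hw : w 0 * w 1 = w 2 ^ 2 := by linarith
  have hV : V 0 * V 1 = 1 + V 2 ^ 2 := by linarith
  have e1 : w 0 * V 1 + w 1 * V 0 = 2 * (w 2 * V 2) := by linarith
  have e2 : (w 0 * V 1 - w 1 * V 0) ^ 2 = - 4 * w 2 ^ 2 := by
    have : (w 0 * V 1 - w 1 * V 0) ^ 2
      = (w 0 * V 1 + w 1 * V 0) ^ 2 - 4 * (w 0 * w 1) * (V 0 * V 1) := by ring
    rw [this, e1, hw, hV]; ring
  have e3 : w 2 = 0 := by nlinarith [sq_nonneg (w 0 * V 1 - w 1 * V 0), sq_nonneg (w 2)]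
  have e4 : w 0 * V 1 - w 1 * V 0 = 0 := by
    rw [e3] at e2; simpa using e2
  rw [e3] at e1 hw
  have hV0 : 0 < V 0 := by nlinarith [sq_nonneg (V 2)]
  have e5 : w 0 = 0 := by
    have : w 0 * V 1 = 0 := by linarith
    rcases mul_eq_zero.1 this with h | h
    · exact h
    · linarith
  have e6 : w 1 = 0 := by
    have : w 1 * V 0 = 0 := by linarith
    rcases mul_eq_zero.1 this with h | h
    · exact h
    · linarith
  ext i
  fin_cases i <;> simp [e3, e5, e6]

lemma lorentz_comb (p q r : ℝ) (a b c u : Fin 3 → ℝ) :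
    lorentz (p • a + q • b + r • c) u = p * lorentz a u + q * lorentz b u + r * lorentz c u := by
  simp [lorentz]; ring

lemma lorentz_toHyp_of_dist {x y : ℍ} {r : ℝ} (h : dist x y = |r|) :
    lorentz (toHyp x) (toHyp y) = Real.cosh r := by
  rw [← cosh_dist_eq_lorentz, h, Real.cosh_abs]

/-- Three points of the hyperbolic plane in geodesic position are linearly dependent. -/
lemma geodesic_relation {t₁ t₂ t₃ : ℝ} {a b x : ℍ} (hab : dist a b = |t₁ - t₂|)
    (hxa : dist x a = |t₃ - t₁|) (hxb : dist x b = |t₃ - t₂|) :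
    Real.sinh (t₃ - t₂) • toHyp a + Real.sinh (t₁ - t₃) • toHyp b
      + Real.sinh (t₂ - t₁) • toHyp x = 0 := by
  have hab' := lorentz_toHyp_of_dist hab
  have hxa' := lorentz_toHyp_of_dist hxa
  have hxb' := lorentz_toHyp_of_dist hxb
  have c1 := Real.cosh_sq t₁
  have c2 := Real.cosh_sq t₂
  have c3 := Real.cosh_sq t₃
  set W := Real.sinh (t₃ - t₂) • toHyp a + Real.sinh (t₁ - t₃) • toHyp b
      + Real.sinh (t₂ - t₁) • toHyp x with hW
  have ha : lorentz W (toHyp a) = 0 := by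
    rw [hW, lorentz_comb, lorentz_self, lorentz_comm (toHyp b), hab', hxa']
    simp only [Real.sinh_sub, Real.cosh_sub]
    linear_combination (Real.sinh t₃ * Real.cosh t₂ - Real.cosh t₃ * Real.sinh t₂) * (- c1)
  have hb : lorentz W (toHyp b) = 0 := by
    rw [hW, lorentz_comb, lorentz_self, hab', hxb']
    simp only [Real.sinh_sub, Real.cosh_sub]
    linear_combination (Real.sinh t₁ * Real.cosh t₃ - Real.cosh t₁ * Real.sinh t₃) * (- c2)
  have hx : lorentz W (toHyp x) = 0 := by
    rw [hW, lorentz_comb, lorentz_self, lorentz_comm (toHyp b), lorentz_comm (toHyp a), hxa', hxb']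
    simp only [Real.sinh_sub, Real.cosh_sub]
    linear_combination (Real.sinh t₂ * Real.cosh t₁ - Real.cosh t₂ * Real.sinh t₁) * (- c3)
  -- `W` is orthogonal to the three vectors it combines, hence also to itself.
  refine eq_zero_of_lorentz_eq_zero ?_ a ha
  conv_lhs => rw [hW]
  rw [lorentz_comb, lorentz_comm _ W, lorentz_comm _ W, lorentz_comm _ W, ha, hb, hx]
  simp

/-- Rigidity of geodesics: two positions on a unit-speed geodesic determine all the others, because
the linear relation can be solved for the third vector. -/
lemma eq_of_geodesic_position {t₁ t₂ t₃ : ℝ} (h : t₁ ≠ t₂) {a b x y : ℍ}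
    (hab : dist a b = |t₁ - t₂|) (hxa : dist x a = |t₃ - t₁|) (hxb : dist x b = |t₃ - t₂|)
    (hya : dist y a = |t₃ - t₁|) (hyb : dist y b = |t₃ - t₂|) : x = y := by
  have h1 := geodesic_relation hab hxa hxb
  have h2 := geodesic_relation hab hya hyb
  have h3 : Real.sinh (t₂ - t₁) • toHyp x = Real.sinh (t₂ - t₁) • toHyp y :=
    add_left_cancel (h1.trans h2.symm)
  have h4 : Real.sinh (t₂ - t₁) ≠ 0 := by
    rw [Ne, Real.sinh_eq_zero, sub_eq_zero]; exact h.symm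
  exact toHyp_injective (smul_right_injective _ h4 h3)

/-- Any two points of the hyperbolic plane are joined by a geodesic segment. -/
lemma exists_geodesic (z w : ℍ) : ∃ c : ℝ → ℍ, Isometry c ∧ c 0 = z ∧ c (dist z w) = w := by
  wlog hzw : z ≠ w generalizing w
  · have hI : ∃ w : ℍ, z ≠ w := (exists_ne z).imp fun _ h => h.symm
    obtain ⟨w', hw'⟩ := hI
    obtain ⟨c, hc, h0, -⟩ := this w' hw'
    refine ⟨c, hc, h0, ?_⟩
    rw [← not_not.1 hzw, dist_self, h0]
  set L := dist z w with hL
  have hLpos : 0 < L := dist_pos.2 hzw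
  have hs : Real.sinh L ≠ 0 := (Real.sinh_pos_iff.2 hLpos).ne'
  have hzw' : lorentz (toHyp z) (toHyp w) = Real.cosh L := (cosh_dist_eq_lorentz z w).symm
  -- The hyperbolic interpolation between the endpoints; the zero term only brings it into the
  -- three-term shape of `lorentz_comb`.
  let X : ℝ → Fin 3 → ℝ := fun t =>
    (Real.sinh (L - t) / Real.sinh L) • toHyp z + (Real.sinh t / Real.sinh L) • toHyp w
      + (0 : ℝ) • toHyp w
  have hXX : ∀ s t, lorentz (X s) (X t) = Real.cosh (s - t) := by
    intro s t
    have hcL := Real.cosh_sq L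
    simp only [X]
    rw [lorentz_comb, lorentz_comm (toHyp z), lorentz_comm (toHyp w), lorentz_comb, lorentz_comb,
      lorentz_self, lorentz_self, lorentz_comm (toHyp w), hzw']
    simp only [Real.sinh_sub, Real.cosh_sub]
    have : Real.sinh L * Real.sinh L ≠ 0 := mul_ne_zero hs hs
    field_simp
    linear_combination (-(Real.sinh s * Real.sinh t)) * hcL
  have h0 : X 0 = toHyp z := by simp [X, hs]
  have hLw : X L = toHyp w := by simp [X, hs]
  have hex : ∀ t, ∃ p, toHyp p = X t := by
    intro t
    refine exists_toHyp_eq (by simp [hXX]) z ?_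
    rw [← h0, hXX]; exact Real.cosh_pos _
  choose c hc using hex
  refine ⟨c, Isometry.of_dist_eq fun s t => ?_, toHyp_injective ((hc 0).trans h0),
    toHyp_injective ((hc L).trans hLw)⟩
  have := cosh_dist_eq_lorentz (c s) (c t)
  rw [hc, hc, hXX, ← Real.cosh_abs (s - t), ← Real.dist_eq] at this
  exact eq_of_cosh_eq dist_nonneg dist_nonneg this

/-! ### Rigidity and transitivity of the isometries of ℍ -/

/-- The Gram matrix of the Lorentzian form. -/
noncomputable def lorentzMatrix : Matrix (Fin 3) (Fin 3) ℝ := !![0, 1/2, 0; 1/2, 0, 0; 0, 0, -1]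

open Matrix in
lemma lorentz_eq_dotProduct (u v : Fin 3 → ℝ) : lorentz u v = u ⬝ᵥ (lorentzMatrix *ᵥ v) := by
  simp [lorentz, lorentzMatrix, Matrix.mulVec, dotProduct, Fin.sum_univ_three]
  ring

open Matrix in
lemma exists_toHyp_eq_mulVec {L : Matrix (Fin 3) (Fin 3) ℝ}
    (hL : ∀ u v, lorentz (L *ᵥ u) (L *ᵥ v) = lorentz u v) {v v' : ℍ}
    (h : L *ᵥ toHyp v = toHyp v') (z : ℍ) : ∃ z', toHyp z' = L *ᵥ toHyp z := by
  refine exists_toHyp_eq (by rw [hL, lorentz_self]) v' ?_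
  rw [← h, hL, ← cosh_dist_eq_lorentz]
  exact Real.cosh_pos _

/-- Every nonempty open ball of the hyperbolic plane spans `ℝ³` in the hyperboloid model. -/
lemma exists_det_ne_zero (v : ℍ) {η : ℝ} (hη : 0 < η) :
    ∃ p : Fin 3 → ℍ, (∀ i, p i ∈ ball v η) ∧ (Matrix.of fun i j => toHyp (p j) i).det ≠ 0 := by
  have hv := v.im_pos
  let q : ℝ → ℝ → ℍ := fun a b => ⟨⟨v.re + a, v.im * Real.exp b⟩, by
    simp only; positivity⟩
  have hre : ∀ a b, (q a b).re = v.re + a := fun _ _ => rfl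
  have him : ∀ a b, (q a b).im = v.im * Real.exp b := fun _ _ => rfl
  have hq : Continuous fun x : ℝ => q x 0 := by
    refine isOpenEmbedding_coe.isEmbedding.continuous_iff.2 ?_
    have : (UpperHalfPlane.coe ∘ fun x : ℝ => q x 0) = fun x : ℝ => (v : ℂ) + x := by
      ext x; apply Complex.ext <;> simp [q]
    rw [this]; fun_prop
  have hq' : Continuous fun x : ℝ => q 0 x := by
    refine isOpenEmbedding_coe.isEmbedding.continuous_iff.2 ?_
    have : (UpperHalfPlane.coe ∘ fun x : ℝ => q 0 x) =
        fun x : ℝ => (v.re : ℂ) + ((v.im * Real.exp x : ℝ) : ℂ) * Complex.I := by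
      ext x; apply Complex.ext <;> simp [q, -Complex.ofReal_exp, -Complex.ofReal_mul]
    rw [this]; fun_prop
  have hq0 : q 0 0 = v := by
    ext
    apply Complex.ext <;> simp [q]
  have e1 : ∀ᶠ x in 𝓝[>] (0 : ℝ), q x 0 ∈ ball v η :=
    (hq.continuousAt.mono_left nhdsWithin_le_nhds).eventually_mem
      (by simpa [hq0] using ball_mem_nhds v hη)
  have e2 : ∀ᶠ x in 𝓝[>] (0 : ℝ), q 0 x ∈ ball v η :=
    (hq'.continuousAt.mono_left nhdsWithin_le_nhds).eventually_mem
      (by simpa [hq0] using ball_mem_nhds v hη)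
  obtain ⟨a, ha, ha0⟩ := (e1.and self_mem_nhdsWithin).exists
  obtain ⟨b, hb, hb0⟩ := (e2.and self_mem_nhdsWithin).exists
  refine ⟨![v, q a 0, q 0 b], ?_, ?_⟩
  · intro i; fin_cases i
    · exact mem_ball_self hη
    · exact ha
    · exact hb
  · have hb1 : 1 < Real.exp b := Real.one_lt_exp_iff.2 hb0
    have ha0 : 0 < a := ha0
    have hrw : (Matrix.of fun i j => toHyp (![v, q a 0, q 0 b] j) i).det =
        a * (Real.exp b - 1) * (Real.exp b + 1) / (v.im * Real.exp b) := by
      rw [Matrix.det_fin_three]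
      simp [toHyp, hre, him]
      field_simp
      ring
    rw [hrw]
    have : 0 < Real.exp b - 1 := by linarith
    positivity

open Matrix in
/-- A distance-preserving map on a ball of the hyperbolic plane extends to a global isometry. -/
lemma exists_isometryEquiv_eqOn_ball {f : ℍ → ℍ} {v : ℍ} {η : ℝ} (hη : 0 < η)
    (hf : ∀ w ∈ ball v η, ∀ w' ∈ ball v η, dist (f w) (f w') = dist w w') :
    ∃ g : ℍ ≃ᵢ ℍ, EqOn g f (ball v η) := by
  obtain ⟨p, hp, hdet⟩ := exists_det_ne_zero v hη
  set J := lorentzMatrix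
  set A : Matrix (Fin 3) (Fin 3) ℝ := Matrix.of fun i j => toHyp (p j) i with hA
  set A' : Matrix (Fin 3) (Fin 3) ℝ := Matrix.of fun i j => toHyp (f (p j)) i with hA'
  have hpres : ∀ w ∈ ball v η, ∀ w' ∈ ball v η,
      lorentz (toHyp (f w)) (toHyp (f w')) = lorentz (toHyp w) (toHyp w') := fun w hw w' hw' => by
    rw [← cosh_dist_eq_lorentz, ← cosh_dist_eq_lorentz, hf w hw w' hw']
  have key : ∀ w ∈ ball v η, Aᵀ *ᵥ (J *ᵥ toHyp w) = A'ᵀ *ᵥ (J *ᵥ toHyp (f w)) := by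
    intro w hw
    ext i
    have := hpres (p i) (hp i) w hw
    rw [lorentz_eq_dotProduct, lorentz_eq_dotProduct] at this
    exact this.symm
  have hcol : ∀ i, A *ᵥ Pi.single i 1 = toHyp (p i) := fun i => by
    rw [Matrix.mulVec_single_one]; rfl
  have hcol' : ∀ i, A' *ᵥ Pi.single i 1 = toHyp (f (p i)) := fun i => by
    rw [Matrix.mulVec_single_one]; rfl
  -- Equal distances mean equal Gram matrices. This makes the images a basis too, and the change of
  -- basis `L` below preserves the form.
  have gram : Aᵀ * J * A = A'ᵀ * J * A' := by
    apply Matrix.ext_of_mulVec_single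
    intro i
    rw [← Matrix.mulVec_mulVec, ← Matrix.mulVec_mulVec, ← Matrix.mulVec_mulVec,
      ← Matrix.mulVec_mulVec, hcol, hcol', key _ (hp i)]
  have hJ : J.det ≠ 0 := by
    simp [J, lorentzMatrix, Matrix.det_fin_three]
  have hdet' : A'.det ≠ 0 := by
    have h := congrArg Matrix.det gram
    simp only [Matrix.det_mul, Matrix.det_transpose] at h
    intro h0
    rw [h0] at h
    simp [hJ, hdet] at h
  have uA : IsUnit A.det := isUnit_iff_ne_zero.2 hdet
  have uA' : IsUnit A'.det := isUnit_iff_ne_zero.2 hdet'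
  have uJ : IsUnit J.det := isUnit_iff_ne_zero.2 hJ
  set L := A' * A⁻¹ with hL
  set K := A * A'⁻¹ with hK
  have hKL : K * L = 1 := by
    rw [hK, hL, Matrix.mul_assoc, ← Matrix.mul_assoc A'⁻¹, Matrix.nonsing_inv_mul _ uA',
      Matrix.one_mul, Matrix.mul_nonsing_inv _ uA]
  have hLK : L * K = 1 := mul_eq_one_comm.1 hKL
  have hLJ : Lᵀ * J * L = J := by
    have h1 : Lᵀ = A⁻¹ᵀ * A'ᵀ := by rw [hL, Matrix.transpose_mul]
    calc Lᵀ * J * L = A⁻¹ᵀ * (A'ᵀ * J * A') * A⁻¹ := by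
          rw [h1, hL]; simp only [Matrix.mul_assoc]
      _ = (A⁻¹ᵀ * Aᵀ) * J * (A * A⁻¹) := by rw [← gram]; simp only [Matrix.mul_assoc]
      _ = J := by
        rw [← Matrix.transpose_mul, Matrix.mul_nonsing_inv _ uA]; simp
  have hLp : ∀ u w, lorentz (L *ᵥ u) (L *ᵥ w) = lorentz u w := by
    intro u w
    rw [lorentz_eq_dotProduct, lorentz_eq_dotProduct]
    rw [Matrix.mulVec_mulVec, ← Matrix.vecMul_transpose, ← Matrix.dotProduct_mulVec,
      Matrix.mulVec_mulVec, ← Matrix.mul_assoc, hLJ]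
  have hKp : ∀ u w, lorentz (K *ᵥ u) (K *ᵥ w) = lorentz u w := by
    intro u w
    rw [← hLp, Matrix.mulVec_mulVec, Matrix.mulVec_mulVec, hLK, Matrix.one_mulVec,
      Matrix.one_mulVec]
  -- A vector is determined by its pairings with the basis `toHyp (f (p i))`, and `key` computes
  -- these pairings for `toHyp (f w)`.
  have hLf : ∀ w ∈ ball v η, L *ᵥ toHyp w = toHyp (f w) := by
    intro w hw
    have hinj : Function.Injective (A'ᵀ * J).mulVec :=
      Matrix.mulVec_injective_of_isUnit ((Matrix.isUnit_iff_isUnit_det _).2 (by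
        rw [Matrix.det_mul, Matrix.det_transpose]; exact uA'.mul uJ))
    apply hinj
    have e : A'ᵀ * J * L = Aᵀ * J := by
      rw [hL, ← Matrix.mul_assoc, ← gram, Matrix.mul_assoc, Matrix.mul_nonsing_inv _ uA,
        Matrix.mul_one]
    rw [Matrix.mulVec_mulVec, e, ← Matrix.mulVec_mulVec, key w hw, Matrix.mulVec_mulVec]
  have hv := hLf v (mem_ball_self hη)
  have hv' : K *ᵥ toHyp (f v) = toHyp v := by
    rw [← hv, Matrix.mulVec_mulVec, hKL, Matrix.one_mulVec]
  choose g hg using exists_toHyp_eq_mulVec hLp hv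
  choose k hk using exists_toHyp_eq_mulVec hKp hv'
  refine ⟨IsometryEquiv.mk' g k (fun z => toHyp_injective ?_) (Isometry.of_dist_eq fun z w => ?_),
    fun w hw => toHyp_injective ?_⟩
  · rw [hg, hk, Matrix.mulVec_mulVec, hLK, Matrix.one_mulVec]
  · exact dist_eq_of_lorentz_eq (by rw [hg, hg, hLp])
  · exact (hg w).trans (hLf w hw)

/-- Two isometries of the hyperbolic plane with the same germ at a point are equal. -/
lemma eq_of_isometry_of_eventuallyEq {g h : ℍ → ℍ} (hg : Isometry g) (hh : Isometry h) {w : ℍ}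
    (e : g =ᶠ[𝓝 w] h) : g = h := by
  funext z
  obtain ⟨c, hc, h0, hT⟩ := exists_geodesic w z
  generalize dist w z = T at hT
  subst hT
  subst h0
  have e' : ∀ᶠ t in 𝓝 (0 : ℝ), g (c t) = h (c t) := hc.continuous.continuousAt.eventually e
  obtain ⟨t, ht, ht0⟩ := ((e'.filter_mono nhdsWithin_le_nhds).and
    (self_mem_nhdsWithin : Ioi (0 : ℝ) ∈ 𝓝[>] 0)).exists
  have ht0 : (0 : ℝ) ≠ t := (mem_Ioi.1 ht0).ne
  have e0 := e'.self_of_nhds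
  refine eq_of_geodesic_position (t₁ := 0) (t₂ := t) (t₃ := T) (a := g (c 0)) (b := g (c t))
    ht0 ?_ ?_ ?_ ?_ ?_
  · rw [hg.dist_eq, hc.dist_eq, Real.dist_eq]
  · rw [hg.dist_eq, hc.dist_eq, Real.dist_eq]
  · rw [hg.dist_eq, hc.dist_eq, Real.dist_eq]
  · rw [e0, hh.dist_eq, hc.dist_eq, Real.dist_eq]
  · rw [ht, hh.dist_eq, hc.dist_eq, Real.dist_eq]

lemma exists_isometryEquiv_apply_eq (z w : ℍ) : ∃ g : ℍ ≃ᵢ ℍ, g z = w := by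
  have : IsIsometricVAdd ℝ ℍ := ⟨isometry_real_vadd⟩
  have : IsIsometricSMul {x : ℝ // 0 < x} ℍ := ⟨isometry_pos_mul⟩
  let a : {x : ℝ // 0 < x} := ⟨w.im / z.im, div_pos w.im_pos z.im_pos⟩
  refine ⟨(IsometryEquiv.constSMul a).trans (IsometryEquiv.constVAdd (w.re - (a • z).re)), ?_⟩
  refine UpperHalfPlane.ext_re_im ?_ ?_
  · simp
  · have := z.im_ne_zero
    simp [a]
    field_simp

/-! ### Germs of local isometries from ℍ to the surface -/

variable {S : Type u} [MetricSpace S]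

/-- `P` restricts to an isometry of the ball of radius `r` about `z` onto the ball of radius `r`
about `P z`. -/
def IsIsometryOnBall (P : ℍ → S) (z : ℍ) (r : ℝ) : Prop :=
  (∀ w ∈ ball z r, ∀ w' ∈ ball z r, dist (P w) (P w') = dist w w') ∧
    P '' ball z r = ball (P z) r

/-- `P` is near `z` an isometry onto a neighbourhood of `P z`. -/
def IsEtaleAt (P : ℍ → S) (z : ℍ) : Prop := ∃ r > 0, IsIsometryOnBall P z r

lemma IsIsometryOnBall.mono {P : ℍ → S} {z w : ℍ} {r ρ : ℝ} (h : IsIsometryOnBall P z r)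
    (hρ : 0 < ρ) (hw : dist w z + ρ ≤ r) : IsIsometryOnBall P w ρ := by
  have hsub : ball w ρ ⊆ ball z r := ball_subset_ball' (by linarith)
  have hwm : w ∈ ball z r := by rw [mem_ball]; linarith
  have hr : 0 < r := pos_of_mem_ball hwm
  have hd := h.1 w hwm z (mem_ball_self hr)
  refine ⟨fun a ha b hb => h.1 a (hsub ha) b (hsub hb), ?_⟩
  ext s
  constructor
  · rintro ⟨a, ha, rfl⟩
    rw [mem_ball, h.1 a (hsub ha) w hwm]; exact ha
  · intro hs
    have : s ∈ ball (P z) r := ball_subset_ball' (by linarith) hs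
    rw [← h.2] at this
    obtain ⟨a, ha, rfl⟩ := this
    exact ⟨a, by rw [mem_ball, ← h.1 a ha w hwm]; exact hs, rfl⟩

lemma IsIsometryOnBall.isEtaleAt {P : ℍ → S} {z w : ℍ} {r : ℝ} (h : IsIsometryOnBall P z r)
    (hw : w ∈ ball z r) : IsEtaleAt P w :=
  ⟨r - dist w z, sub_pos.2 hw, h.mono (sub_pos.2 hw) (by linarith)⟩

lemma IsIsometryOnBall.injOn {P : ℍ → S} {z : ℍ} {r : ℝ} (h : IsIsometryOnBall P z r) :
    InjOn P (ball z r) := fun a ha b hb hab => by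
  rw [← dist_eq_zero, ← h.1 a ha b hb, hab, dist_self]

lemma IsEtaleAt.eventually {P : ℍ → S} {z : ℍ} (h : IsEtaleAt P z) :
    ∀ᶠ w in 𝓝 z, IsEtaleAt P w := by
  obtain ⟨r, hr, h⟩ := h
  filter_upwards [ball_mem_nhds z hr] with w hw using h.isEtaleAt hw

lemma IsEtaleAt.congr {P P' : ℍ → S} {z : ℍ} (h : IsEtaleAt P z) (e : P =ᶠ[𝓝 z] P') :
    IsEtaleAt P' z := by
  obtain ⟨r, hr, h⟩ := h
  obtain ⟨r', hr', e⟩ := Metric.eventually_nhds_iff_ball.1 e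
  obtain ⟨h1, h2⟩ := h.mono (w := z) (ρ := min r r') (lt_min hr hr') (by simp)
  have hs : ball z (min r r') ⊆ ball z r' := ball_subset_ball (min_le_right _ _)
  refine ⟨min r r', lt_min hr hr', fun w hw w' hw' => ?_, ?_⟩
  · rw [← e w (hs hw), ← e w' (hs hw'), h1 w hw w' hw']
  · rw [← e z (mem_ball_self hr'), ← h2]
    exact image_congr fun w hw => (e w (hs hw)).symm

lemma IsEtaleAt.comp_isometryEquiv {P : ℍ → S} {z : ℍ} (g : ℍ ≃ᵢ ℍ) (h : IsEtaleAt P (g z)) :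
    IsEtaleAt (P ∘ g) z := by
  obtain ⟨r, hr, h1, h2⟩ := h
  have hm : ∀ w ∈ ball z r, g w ∈ ball (g z) r := fun w hw => by
    rwa [mem_ball, g.isometry.dist_eq]
  refine ⟨r, hr, fun w hw w' hw' => ?_, ?_⟩
  · simp only [Function.comp_apply]
    rw [h1 _ (hm w hw) _ (hm w' hw'), g.isometry.dist_eq]
  · rw [image_comp, IsometryEquiv.image_ball, h2, Function.comp_apply]

lemma IsIsometryOnBall.continuousAt {P : ℍ → S} {z : ℍ} {r : ℝ} (hr : 0 < r)
    (h : IsIsometryOnBall P z r) : ContinuousAt P z := by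
  rw [Metric.continuousAt_iff]
  intro ε hε
  refine ⟨min r ε, lt_min hr hε, fun {w} hw => ?_⟩
  rw [h.1 w (hw.trans_le (min_le_left _ _)) z (mem_ball_self hr)]
  exact hw.trans_le (min_le_right _ _)

lemma IsEtaleAt.continuousAt {P : ℍ → S} {z : ℍ} (h : IsEtaleAt P z) : ContinuousAt P z :=
  h.choose_spec.2.continuousAt h.choose_spec.1

/-- A germ of an isometry into a given chart differs from this chart by an isometry of the
hyperbolic plane. -/
lemma IsIsometryOnBall.exists_comp_eventuallyEq {P φ : ℍ → S} {y z : ℍ} {r : ℝ}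
    (hφ : IsIsometryOnBall φ y r) (hP : IsEtaleAt P z) (hz : P z ∈ ball (φ y) r) :
    ∃ g : ℍ ≃ᵢ ℍ, φ ∘ g =ᶠ[𝓝 z] P ∧ g z ∈ ball y r := by
  have hinv : ∀ s : S, ∃ w, s ∈ ball (φ y) r → w ∈ ball y r ∧ φ w = s := by
    intro s
    by_cases hs : s ∈ ball (φ y) r
    · rw [← hφ.2] at hs
      obtain ⟨w, hw, e⟩ := hs
      exact ⟨w, fun _ => ⟨hw, e⟩⟩
    · exact ⟨y, fun h => absurd h hs⟩
  choose ψ hψ using hinv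
  have hcont : ∀ᶠ w in 𝓝 z, P w ∈ ball (φ y) r :=
    hP.continuousAt.eventually_mem (isOpen_ball.mem_nhds hz)
  obtain ⟨r₁, hr₁, e₁⟩ := Metric.eventually_nhds_iff_ball.1 hcont
  obtain ⟨r₂, hr₂, e₂⟩ := hP
  set η := min r₁ r₂
  have hη : 0 < η := lt_min hr₁ hr₂
  have hη₁ : ball z η ⊆ ball z r₁ := ball_subset_ball (min_le_left _ _)
  have hη₂ : ball z η ⊆ ball z r₂ := ball_subset_ball (min_le_right _ _)
  obtain ⟨g, hg⟩ := exists_isometryEquiv_eqOn_ball (f := ψ ∘ P) hη (fun w hw w' hw' => by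
    have h1 := hψ _ (e₁ w (hη₁ hw))
    have h2 := hψ _ (e₁ w' (hη₁ hw'))
    simp only [Function.comp_apply]
    rw [← hφ.1 _ h1.1 _ h2.1, h1.2, h2.2, e₂.1 w (hη₂ hw) w' (hη₂ hw')])
  refine ⟨g, ?_, ?_⟩
  · filter_upwards [ball_mem_nhds z hη] with w hw
    rw [Function.comp_apply, hg hw]
    exact (hψ _ (e₁ w (hη₁ hw))).2
  · rw [hg (mem_ball_self hη)]
    exact (hψ _ hz).1

/-- Identity principle: near z, P' is P ∘ g for an isometry g of ℍ. At a nearby point where the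
germs of P and P' agree, injectivity of P forces g to have the germ of the identity, so g is the
identity. -/
lemma IsEtaleAt.eventuallyEq_of_frequently {P P' : ℍ → S} {z : ℍ} (hP : IsEtaleAt P z)
    (hP' : IsEtaleAt P' z) (h : ∃ᶠ w in 𝓝 z, P =ᶠ[𝓝 w] P') : P =ᶠ[𝓝 z] P' := by
  obtain ⟨r, hr, hr1⟩ := hP
  have hz : P' z ∈ ball (P z) r := by
    obtain ⟨r', hr', hr1'⟩ := hP'
    obtain ⟨w, hw, hwm⟩ := (h.and_eventually
      (ball_mem_nhds z (lt_min (half_pos hr) hr'))).exists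
    have hw1 : dist w z < r / 2 := lt_of_lt_of_le hwm (min_le_left _ _)
    have hw2 : dist w z < r' := lt_of_lt_of_le hwm (min_le_right _ _)
    have e1 : dist (P w) (P z) = dist w z :=
      hr1.1 w (by rw [mem_ball]; linarith) z (mem_ball_self hr)
    have e2 : dist (P' w) (P' z) = dist w z := hr1'.1 w hw2 z (mem_ball_self hr')
    rw [← hw.self_of_nhds] at e2
    rw [mem_ball]
    have := dist_triangle_left (P' z) (P z) (P w)
    linarith
  obtain ⟨g, hg, hgz⟩ := hr1.exists_comp_eventuallyEq hP' hz
  have hgm : ∀ᶠ w in 𝓝 z, g w ∈ ball z r :=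
    g.continuous.continuousAt.eventually_mem (isOpen_ball.mem_nhds hgz)
  obtain ⟨w, hw, ⟨hw1, hw2⟩, hw3⟩ := (h.and_eventually
    ((hg.eventually_nhds.and hgm.eventually_nhds).and (eventually_mem_nhds_iff.2 (ball_mem_nhds z hr)))).exists
  have hid : g =ᶠ[𝓝 w] id := by
    filter_upwards [hw, hw1, hw2, hw3] with u h1 h2 h3 h4
    exact hr1.injOn h3 h4 (h2.trans h1.symm)
  have := eq_of_isometry_of_eventuallyEq g.isometry isometry_id hid
  rw [this] at hg
  exact hg

lemma IsEtaleAt.eventually_eventuallyEq_iff {P P' : ℍ → S} {z : ℍ} (hP : IsEtaleAt P z)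
    (hP' : IsEtaleAt P' z) : ∀ᶠ w in 𝓝 z, (P =ᶠ[𝓝 w] P' ↔ P =ᶠ[𝓝 z] P') := by
  by_cases h : P =ᶠ[𝓝 z] P'
  · filter_upwards [h.eventually_nhds] with w hw using iff_of_true hw h
  · have : ∀ᶠ w in 𝓝 z, ¬ P =ᶠ[𝓝 w] P' := by
      by_contra h'
      exact h (hP.eventuallyEq_of_frequently hP' h')
    filter_upwards [this] with w hw using iff_of_false hw h

/-! ### Analytic continuation of germs -/

section Continuation

variable {B : Type*} [TopologicalSpace B]

/-- The family `Q` of germs of isometries at the points `f b` is locally constant at `b`. -/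
def IsContinuationAt (f : B → ℍ) (Q : B → ℍ → S) (b : B) : Prop :=
  IsEtaleAt (Q b) (f b) ∧ ∀ᶠ b' in 𝓝 b, Q b' =ᶠ[𝓝 (f b')] Q b

lemma IsEtaleAt.isContinuationAt_const {f : B → ℍ} {P : ℍ → S} {b : B}
    (h : IsEtaleAt P (f b)) : IsContinuationAt f (fun _ => P) b :=
  ⟨h, Eventually.of_forall fun _ => EventuallyEq.rfl⟩

lemma IsContinuationAt.eventually_eventuallyEq_iff {f : B → ℍ} {Q Q' : B → ℍ → S} {b : B}
    (hf : ContinuousAt f b) (hQ : IsContinuationAt f Q b) (hQ' : IsContinuationAt f Q' b) :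
    ∀ᶠ b' in 𝓝 b, (Q b' =ᶠ[𝓝 (f b')] Q' b' ↔ Q b =ᶠ[𝓝 (f b)] Q' b) := by
  filter_upwards [hQ.2, hQ'.2, hf.eventually (hQ.1.eventually_eventuallyEq_iff hQ'.1)]
    with b' h1 h2 h3
  rw [← h3]
  exact ⟨fun h => h1.symm.trans (h.trans h2), fun h => h1.trans (h.trans h2.symm)⟩

/-- Uniqueness of analytic continuation. -/
lemma eventuallyEq_of_isPreconnected {f : B → ℍ} (hf : Continuous f) {Q Q' : B → ℍ → S}
    {s : Set B} (hs : IsPreconnected s) (hQ : ∀ b ∈ s, IsContinuationAt f Q b)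
    (hQ' : ∀ b ∈ s, IsContinuationAt f Q' b) {b₀ b : B} (hb₀ : b₀ ∈ s) (hb : b ∈ s)
    (h₀ : Q b₀ =ᶠ[𝓝 (f b₀)] Q' b₀) : Q b =ᶠ[𝓝 (f b)] Q' b := by
  have := hs.induction₂ (fun x y => (Q x =ᶠ[𝓝 (f x)] Q' x ↔ Q y =ᶠ[𝓝 (f y)] Q' y))
    (fun x hx => ?_) (fun x y z _ _ _ h1 h2 => h1.trans h2) (fun x y _ _ h => h.symm) hb₀ hb
  · exact this.1 h₀
  · have := (hQ x hx).eventually_eventuallyEq_iff hf.continuousAt (hQ' x hx)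
    exact (this.filter_mono nhdsWithin_le_nhds).mono fun y hy => hy.symm

end Continuation

/-! ### Charts and continuation along geodesics -/

/-- Charts exist at every point, with an arbitrary base point in the hyperbolic plane. -/
lemma exists_isEtaleAt (hS : IsHyperbolicSurface S) (s : S) (z : ℍ) :
    ∃ φ : ℍ → S, φ z = s ∧ IsEtaleAt φ z := by
  classical
  obtain ⟨U, hU, hsU, V, hV, ⟨e⟩⟩ := hS.locally_isometric s
  set v : V := e ⟨s, hsU⟩ with hv
  obtain ⟨g, hg⟩ := exists_isometryEquiv_apply_eq z (v : ℍ)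
  let φ : ℍ → S := fun w => if h : w ∈ V then (e.symm ⟨w, h⟩ : S) else s
  have hφ : ∀ w (h : w ∈ V), φ w = e.symm ⟨w, h⟩ := fun w h => dif_pos h
  have hφv : φ v = s := by
    rw [hφ _ v.2]; simp [hv]
  obtain ⟨r₁, hr₁, h1⟩ := Metric.isOpen_iff.1 hU s hsU
  obtain ⟨r₂, hr₂, h2⟩ := Metric.isOpen_iff.1 hV v v.2
  set r := min r₁ r₂
  have hr : 0 < r := lt_min hr₁ hr₂
  have hrU : ball s r ⊆ U := (ball_subset_ball (min_le_left _ _)).trans h1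
  have hrV : ball (v : ℍ) r ⊆ V := (ball_subset_ball (min_le_right _ _)).trans h2
  have hiso : ∀ w ∈ V, ∀ w' ∈ V, dist (φ w) (φ w') = dist w w' := by
    intro w hw w' hw'
    rw [hφ w hw, hφ w' hw', ← Subtype.dist_eq, e.symm.isometry.dist_eq, Subtype.dist_eq]
  have hE : IsEtaleAt φ v := by
    refine ⟨r, hr, fun w hw w' hw' => hiso w (hrV hw) w' (hrV hw'), ?_⟩
    ext t
    constructor
    · rintro ⟨w, hw, rfl⟩
      rw [mem_ball, hiso w (hrV hw) v v.2]; exact hw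
    · intro ht
      rw [hφv] at ht
      have htU := hrU ht
      refine ⟨e ⟨t, htU⟩, ?_, ?_⟩
      · rw [mem_ball, ← Subtype.dist_eq, hv, e.isometry.dist_eq]; exact ht
      · rw [hφ _ (e ⟨t, htU⟩).2]; simp
  exact ⟨φ ∘ g, by rw [Function.comp_apply, hg, hφv], IsEtaleAt.comp_isometryEquiv g (hg ▸ hE)⟩

/-- Near each time `T`, the germs of isometries which match a geodesic of the hyperbolic plane with
a geodesic of the surface extend to a neighbourhood of `T` of uniform size. -/
lemma exists_uniform_extension (hS : IsHyperbolicSurface S) {c : ℝ → ℍ} (hc : Isometry c)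
    {c' : ℝ → S} (hc' : IsUnitSpeedGeodesicOn c' univ) (T : ℝ) :
    ∃ δ > 0, ∀ t₁ ∈ ball T δ, ∀ P : ℍ → S, IsEtaleAt P (c t₁) → P ∘ c =ᶠ[𝓝 t₁] c' →
      ∃ P' : ℍ → S, P' =ᶠ[𝓝 (c t₁)] P ∧ ∀ t ∈ ball T δ, IsEtaleAt P' (c t) ∧ P' (c t) = c' t := by
  obtain ⟨ε, hε, hε'⟩ := hc' T (mem_univ _)
  obtain ⟨φ, hφT, r, hr, hφ⟩ := exists_isEtaleAt hS (c' T) (c T)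
  set δ := min ε r
  have hδ : 0 < δ := lt_min hε hr
  have hgeo : ∀ s ∈ ball T δ, ∀ t ∈ ball T δ, dist (c' s) (c' t) = |s - t| := fun s hs t ht =>
    hε' s (mem_univ _) t (mem_univ _) (lt_of_lt_of_le hs (min_le_left _ _))
      (lt_of_lt_of_le ht (min_le_left _ _))
  have hmem : ∀ t ∈ ball T δ, c' t ∈ ball (φ (c T)) r := fun t ht => by
    rw [hφT, mem_ball, hgeo t ht T (mem_ball_self hδ)]
    exact lt_of_lt_of_le ht (min_le_right _ _)
  have hlift : ∀ t, ∃ w, t ∈ ball T δ → w ∈ ball (c T) r ∧ φ w = c' t := by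
    intro t
    by_cases ht : t ∈ ball T δ
    · have := hmem t ht
      rw [← hφ.2] at this
      obtain ⟨w, hw⟩ := this
      exact ⟨w, fun _ => hw⟩
    · exact ⟨c T, fun h => absurd h ht⟩
  choose h hh using hlift
  refine ⟨δ, hδ, fun t₁ ht₁ P hP hPc => ?_⟩
  have hPt : P (c t₁) = c' t₁ := hPc.self_of_nhds
  obtain ⟨g, hg, hgm⟩ := hφ.exists_comp_eventuallyEq hP (by rw [hPt]; exact hmem t₁ ht₁)
  have hhdist : ∀ s ∈ ball T δ, ∀ t ∈ ball T δ, dist (h s) (h t) = |s - t| := fun s hs t ht => by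
    rw [← hφ.1 _ (hh s hs).1 _ (hh t ht).1, (hh s hs).2, (hh t ht).2, hgeo s hs t ht]
  have hev : ∀ᶠ t in 𝓝 t₁, g (c t) = h t ∧ t ∈ ball T δ := by
    have e1 : ∀ᶠ t in 𝓝 t₁, g (c t) ∈ ball (c T) r :=
      (g.continuous.comp hc.continuous).continuousAt.eventually_mem (isOpen_ball.mem_nhds hgm)
    have e2 : ∀ᶠ t in 𝓝 t₁, (φ ∘ g) (c t) = P (c t) := hc.continuous.continuousAt.eventually hg
    filter_upwards [e1, e2, hPc, isOpen_ball.mem_nhds ht₁] with t h1 h2 h3 h4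
    exact ⟨hφ.injOn h1 (hh t h4).1 (h2.trans (h3.trans (hh t h4).2.symm)), h4⟩
  obtain ⟨t₂, ⟨e2, ht₂⟩, ht₁₂⟩ := ((hev.filter_mono nhdsWithin_le_nhds).and
    (self_mem_nhdsWithin : Ioi t₁ ∈ 𝓝[>] t₁)).exists
  have e1 := hev.self_of_nhds.1
  -- Both `g ∘ c` and the chart lift `h` have unit speed on the whole ball and agree at two times,
  -- so they agree throughout. Hence δ depends on neither `t₁` nor `P`.
  have hall : ∀ t ∈ ball T δ, g (c t) = h t := by
    intro t ht
    refine eq_of_geodesic_position (t₁ := t₁) (t₂ := t₂) (t₃ := t) (a := h t₁) (b := h t₂)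
      (mem_Ioi.1 ht₁₂).ne (hhdist _ ht₁ _ ht₂) ?_ ?_ (hhdist _ ht _ ht₁) (hhdist _ ht _ ht₂)
    · rw [← e1, g.isometry.dist_eq, hc.dist_eq, Real.dist_eq]
    · rw [← e2, g.isometry.dist_eq, hc.dist_eq, Real.dist_eq]
  refine ⟨φ ∘ g, hg, fun t ht => ⟨IsEtaleAt.comp_isometryEquiv g ?_, ?_⟩⟩
  · rw [hall t ht]; exact hφ.isEtaleAt (hh t ht).1
  · rw [Function.comp_apply, hall t ht, (hh t ht).2]

/-- In a geodesically complete surface, a germ of isometry extends along a whole geodesic. -/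
lemma exists_continuation_along_geodesic (hS : IsHyperbolicSurface S)
    (hcomp : GeodesicallyComplete S) {c : ℝ → ℍ} (hc : Isometry c) {P₀ : ℍ → S}
    (hP₀ : IsEtaleAt P₀ (c 0)) :
    ∃ Q : ℝ → ℍ → S, (∀ t, IsContinuationAt c Q t) ∧ Q 0 =ᶠ[𝓝 (c 0)] P₀ := by
  classical
  have hcc := hc.continuous
  obtain ⟨r, hr, hr1⟩ := id hP₀
  have hball : ∀ t ∈ Ioo (-r) r, c t ∈ ball (c 0) r := fun t ht => by
    rw [mem_ball, hc.dist_eq, Real.dist_eq, sub_zero, abs_lt]; exact ht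
  -- The only use of completeness: the image geodesic c' exists for all times and shows where the
  -- continued germ must go.
  obtain ⟨c', hc', hcP⟩ := hcomp (-r) r (P₀ ∘ c) (by linarith) (fun t _ => by
    refine ⟨1, one_pos, fun s hs s' hs' _ _ => ?_⟩
    rw [Function.comp_apply, Function.comp_apply, hr1.1 _ (hball s hs) _ (hball s' hs'),
      hc.dist_eq, Real.dist_eq])
  have hcP₀ : P₀ ∘ c =ᶠ[𝓝 0] c' := by
    filter_upwards [Ioo_mem_nhds (neg_lt_zero.2 hr) hr] with t ht using (hcP ht).symm
  let D : Set ℝ → (ℝ → ℍ → S) → Prop := fun J Q => IsOpen J ∧ J.OrdConnected ∧ (0 : ℝ) ∈ J ∧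
    (∀ s ∈ J, IsContinuationAt c Q s ∧ Q s ∘ c =ᶠ[𝓝 s] c') ∧ Q 0 =ᶠ[𝓝 (c 0)] P₀
  -- The times reached by a continuation that follows c'. This set is open by definition and closed
  -- by the uniform extension, hence all of ℝ.
  let X : Set ℝ := {t | ∃ J Q, D J Q ∧ t ∈ J}
  have hX0 : (0 : ℝ) ∈ X := by
    have e1 : ∀ᶠ t in 𝓝 (0 : ℝ), IsEtaleAt P₀ (c t) ∧ P₀ ∘ c =ᶠ[𝓝 t] c' :=
      (hcc.continuousAt.eventually hP₀.eventually).and hcP₀.eventually_nhds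
    obtain ⟨δ, hδ, e1⟩ := Metric.eventually_nhds_iff_ball.1 e1
    exact ⟨ball 0 δ, fun _ => P₀, ⟨isOpen_ball, (isPreconnected_ball).ordConnected,
      mem_ball_self hδ, fun s hs => ⟨(e1 s hs).1.isContinuationAt_const, (e1 s hs).2⟩,
      EventuallyEq.rfl⟩, mem_ball_self hδ⟩
  have hXo : IsOpen X := by
    rw [isOpen_iff_mem_nhds]
    rintro t ⟨J, Q, hD, ht⟩
    filter_upwards [hD.1.mem_nhds ht] with t' ht' using ⟨J, Q, hD, ht'⟩
  have hXc : IsClosed X := by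
    refine isClosed_of_closure_subset fun T hT => ?_
    obtain ⟨δ, hδ, hext⟩ := exists_uniform_extension hS hc hc' T
    obtain ⟨t₁, ht₁, ⟨J, Q, ⟨hJo, hJc, hJ0, hJQ, hQ0⟩, ht₁J⟩⟩ :=
      mem_closure_iff.1 hT (ball T δ) isOpen_ball (mem_ball_self hδ)
    obtain ⟨P', hP', hP'2⟩ := hext t₁ ht₁ (Q t₁) (hJQ t₁ ht₁J).1.1 (hJQ t₁ ht₁J).2
    have hagree : ∀ s ∈ J ∩ ball T δ, Q s =ᶠ[𝓝 (c s)] P' := fun s hs =>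
      eventuallyEq_of_isPreconnected (Q' := fun _ => P') hcc
        (hJc.inter (isPreconnected_ball).ordConnected).isPreconnected
        (fun b hb => (hJQ b hb.1).1)
        (fun b hb => (hP'2 b hb.2).1.isContinuationAt_const) ⟨ht₁J, ht₁⟩ hs hP'.symm
    refine ⟨J ∪ ball T δ, fun s => if s ∈ J then Q s else P',
      ⟨hJo.union isOpen_ball, ?_, Or.inl hJ0, fun s hs => ?_, ?_⟩, Or.inr (mem_ball_self hδ)⟩
    · exact (IsPreconnected.union t₁ ht₁J ht₁ hJc.isPreconnected isPreconnected_ball).ordConnected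
    · by_cases hsJ : s ∈ J
      · refine ⟨⟨?_, ?_⟩, ?_⟩
        · simp only [hsJ, if_true]; exact (hJQ s hsJ).1.1
        · filter_upwards [(hJQ s hsJ).1.2, hJo.mem_nhds hsJ] with s' h1 h2
          simp only [hsJ, h2, if_true]; exact h1
        · simp only [hsJ, if_true]; exact (hJQ s hsJ).2
      · have hsb : s ∈ ball T δ := hs.resolve_left hsJ
        refine ⟨⟨?_, ?_⟩, ?_⟩
        · simp only [hsJ, if_false]; exact (hP'2 s hsb).1
        · filter_upwards [isOpen_ball.mem_nhds hsb] with s' h1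
          by_cases hs' : s' ∈ J
          · simp only [hs', hsJ, if_true, if_false]; exact hagree s' ⟨hs', h1⟩
          · simp only [hs', hsJ, if_false]; exact EventuallyEq.rfl
        · simp only [hsJ, if_false]
          filter_upwards [isOpen_ball.mem_nhds hsb] with s' h1 using (hP'2 s' h1).2
    · simp only [hJ0, if_true]; exact hQ0
  have hX : ∀ t, t ∈ X := fun t =>
    (IsClopen.eq_univ ⟨hXc, hXo⟩ ⟨0, hX0⟩).symm ▸ mem_univ t
  choose J Q hD hJ using hX
  -- The continuations on different intervals agree on overlaps: these are intervals containing 0,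
  -- where the germs coincide.
  refine ⟨fun t => Q t t, fun t => ⟨((hD t).2.2.2.1 t (hJ t)).1.1, ?_⟩, (hD 0).2.2.2.2⟩
  filter_upwards [((hD t).2.2.2.1 t (hJ t)).1.2, (hD t).1.mem_nhds (hJ t)] with t' h1 h2
  refine EventuallyEq.trans ?_ h1
  exact eventuallyEq_of_isPreconnected hcc
    ((hD t').2.1.inter (hD t).2.1).isPreconnected
    (fun b hb => ((hD t').2.2.2.1 b hb.1).1) (fun b hb => ((hD t).2.2.2.1 b hb.2).1)
    ⟨(hD t').2.2.1, (hD t).2.2.1⟩ ⟨hJ t', h2⟩ ((hD t').2.2.2.2.trans (hD t).2.2.2.2.symm)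

/-- Continuation along a continuous family of geodesics is locally constant. -/
lemma exists_continuation_along_family (hS : IsHyperbolicSurface S)
    (hcomp : GeodesicallyComplete S) {A : Type*} [TopologicalSpace A] {f : A × ℝ → ℍ}
    (hf : Continuous f) (hgeo : ∀ a, Isometry fun t => f (a, t)) {Q₀ : A → ℍ → S}
    (hQ₀ : ∀ a, IsContinuationAt (fun a => f (a, 0)) Q₀ a) :
    ∃ Q : A × ℝ → ℍ → S, (∀ b, IsContinuationAt f Q b) ∧
      ∀ a, Q (a, 0) =ᶠ[𝓝 (f (a, 0))] Q₀ a := by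
  have hline := fun a => exists_continuation_along_geodesic hS hcomp (hgeo a) (hQ₀ a).1
  choose q hq hq0 using hline
  -- The single map `q a₀ T` is étale on a whole neighbourhood of `f (a₀, T)`, so agreement at one
  -- time `t₁` spreads along each nearby geodesic by uniqueness.
  have key : ∀ (a₀ : A) (T : ℝ), ∃ δ > 0, ∀ t₁ ∈ ball T δ,
      (∀ᶠ a in 𝓝 a₀, q a t₁ =ᶠ[𝓝 (f (a, t₁))] q a₀ t₁) →
      ∀ᶠ a in 𝓝 a₀, ∀ t ∈ ball T δ, q a t =ᶠ[𝓝 (f (a, t))] q a₀ T := by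
    intro a₀ T
    have e1 : ∀ᶠ b in 𝓝 (a₀, T), IsEtaleAt (q a₀ T) (f b) :=
      hf.continuousAt.eventually (hq a₀ T).1.eventually
    rw [nhds_prod_eq] at e1
    obtain ⟨p, hp, p', hp', e1⟩ := Filter.eventually_prod_iff.1 e1
    obtain ⟨δ, hδ, e2⟩ := Metric.eventually_nhds_iff_ball.1 (hp'.and (hq a₀ T).2)
    refine ⟨δ, hδ, fun t₁ ht₁ h1 => ?_⟩
    have e3 : ∀ᶠ a in 𝓝 a₀, q a₀ t₁ =ᶠ[𝓝 (f (a, t₁))] q a₀ T := by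
      have hcont : ContinuousAt (fun a => f (a, t₁)) a₀ := by fun_prop
      exact hcont.eventually (e2 t₁ ht₁).2.eventually_nhds
    filter_upwards [h1, e3, hp] with a h1 h3 ha t ht
    exact eventuallyEq_of_isPreconnected (f := fun t => f (a, t)) (Q := q a)
      (Q' := fun _ => q a₀ T) (hgeo a).continuous (isPreconnected_ball (x := T) (r := δ))
      (fun s _ => hq a s)
      (fun s hs => IsEtaleAt.isContinuationAt_const (e1 ha (e2 s hs).1)) ht₁ ht (h1.trans h3)
  have hG : ∀ a₀ t, ∀ᶠ a in 𝓝 a₀, q a t =ᶠ[𝓝 (f (a, t))] q a₀ t := by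
    intro a₀
    have h0 : ∀ᶠ a in 𝓝 a₀, q a 0 =ᶠ[𝓝 (f (a, 0))] q a₀ 0 := by
      have hcont : ContinuousAt (fun a => f (a, (0 : ℝ))) a₀ := by fun_prop
      filter_upwards [(hQ₀ a₀).2, hcont.eventually (hq0 a₀).eventually_nhds] with a h1 h2
      exact (hq0 a).trans (h1.trans (EventuallyEq.symm h2))
    have hloc : ∀ T : ℝ, ∃ δ > 0, ∀ t₁ ∈ ball T δ, ∀ t ∈ ball T δ,
        (∀ᶠ a in 𝓝 a₀, q a t₁ =ᶠ[𝓝 (f (a, t₁))] q a₀ t₁) →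
        (∀ᶠ a in 𝓝 a₀, q a t =ᶠ[𝓝 (f (a, t))] q a₀ t) := by
      intro T
      obtain ⟨δ, hδ, h⟩ := key a₀ T
      refine ⟨δ, hδ, fun t₁ ht₁ t ht h1 => ?_⟩
      have h2 := h t₁ ht₁ h1
      have hcont : ContinuousAt (fun a => f (a, t)) a₀ := by fun_prop
      filter_upwards [h2, hcont.eventually (h2.self_of_nhds t ht).eventually_nhds] with a h3 h4
      exact (h3 t ht).trans (EventuallyEq.symm h4)
    have := fun t => (isPreconnected_univ (α := ℝ)).induction₂ (y := t)
      (fun x y => (∀ᶠ a in 𝓝 a₀, q a x =ᶠ[𝓝 (f (a, x))] q a₀ x) ↔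
        (∀ᶠ a in 𝓝 a₀, q a y =ᶠ[𝓝 (f (a, y))] q a₀ y)) (fun T _ => ?_)
      (fun x y z _ _ _ h1 h2 => h1.trans h2) (fun x y _ _ h => h.symm) (mem_univ 0) (mem_univ t)
    · exact fun t => (this t).1 h0
    · obtain ⟨δ, hδ, h⟩ := hloc T
      rw [nhdsWithin_univ]
      filter_upwards [ball_mem_nhds T hδ] with t ht
      exact ⟨h T (mem_ball_self hδ) t ht, h t ht T (mem_ball_self hδ)⟩
  refine ⟨fun b => q b.1 b.2, fun ⟨a₀, T⟩ => ⟨(hq a₀ T).1, ?_⟩, hq0⟩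
  obtain ⟨δ, hδ, h⟩ := key a₀ T
  have h1 := h T (mem_ball_self hδ) (hG a₀ T)
  rw [nhds_prod_eq]
  exact (h1.prod_mk (ball_mem_nhds T hδ)).mono fun ⟨a, t⟩ h => h.1 t h.2

/-! ### Fermi coordinates and the developing map -/

/-- Fermi coordinates of the hyperbolic plane along the imaginary axis. -/
noncomputable def fermi (p : ℝ × ℝ) : ℍ :=
  ⟨⟨Real.exp p.1 * (Real.sinh p.2 / Real.cosh p.2), Real.exp p.1 / Real.cosh p.2⟩,
    div_pos (Real.exp_pos _) (Real.cosh_pos _)⟩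

lemma fermi_re (p : ℝ × ℝ) : (fermi p).re = Real.exp p.1 * (Real.sinh p.2 / Real.cosh p.2) := rfl

lemma fermi_im (p : ℝ × ℝ) : (fermi p).im = Real.exp p.1 / Real.cosh p.2 := rfl

lemma continuous_fermi : Continuous fermi := by
  refine isOpenEmbedding_coe.isEmbedding.continuous_iff.2 ?_
  have : (UpperHalfPlane.coe ∘ fermi) = fun p : ℝ × ℝ =>
      ((Real.exp p.1 * (Real.sinh p.2 / Real.cosh p.2) : ℝ) : ℂ) +
        ((Real.exp p.1 / Real.cosh p.2 : ℝ) : ℂ) * Complex.I := by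
    ext p
    exact (UpperHalfPlane.re_add_im (fermi p)).symm
  rw [this]
  have h : ∀ p : ℝ × ℝ, Real.cosh p.2 ≠ 0 := fun p => (Real.cosh_pos _).ne'
  have h1 : Continuous fun p : ℝ × ℝ => Real.exp p.1 * (Real.sinh p.2 / Real.cosh p.2) := by
    fun_prop (disch := assumption)
  have h2 : Continuous fun p : ℝ × ℝ => Real.exp p.1 / Real.cosh p.2 := by
    fun_prop (disch := assumption)
  fun_prop

lemma isometry_fermi (v : ℝ) : Isometry fun u => fermi (v, u) := by
  refine Isometry.of_dist_eq fun s t => ?_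
  refine eq_of_cosh_eq dist_nonneg dist_nonneg ?_
  rw [cosh_dist_eq_lorentz, Real.dist_eq, Real.cosh_abs, Real.cosh_sub]
  have h1 := Real.cosh_sq s
  have h2 := Real.cosh_sq t
  have := (Real.cosh_pos s).ne'
  have := (Real.cosh_pos t).ne'
  simp [lorentz, toHyp, fermi_re, fermi_im, -coe_re, -coe_im]
  field_simp
  linear_combination (-Real.cosh t ^ 2) * h1 - Real.cosh s ^ 2 * h2

lemma isometry_fermi_axis : Isometry fun v => fermi (v, 0) := by
  refine Isometry.of_dist_eq fun s t => ?_
  rw [dist_of_re_eq (by simp [fermi_re, -coe_re])]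
  simp [fermi_im, -coe_im]

/-- Curves of constant first coordinate are the semicircles about 0, so that coordinate is log |z|;
sinh of the other is re/im. -/
lemma exists_fermi_section : ∃ k : ℍ → ℝ × ℝ, Continuous k ∧ (∀ z, fermi (k z) = z) ∧
    k (fermi (0, 0)) = (0, 0) := by
  refine ⟨fun z => (Real.log ‖(z : ℂ)‖, Real.arsinh (z.re / z.im)), ?_, fun z => ?_, ?_⟩
  · have h1 : ∀ z : ℍ, ‖(z : ℂ)‖ ≠ 0 := fun z => norm_ne_zero_iff.2 z.ne_zero
    have h2 : ∀ z : ℍ, z.im ≠ 0 := fun z => z.im_ne_zero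
    have h3 : Continuous fun z : ℍ => z.re / z.im :=
      continuous_re.div continuous_im h2
    exact (continuous_coe.norm.log h1).prodMk (Real.continuous_arsinh.comp h3)
  · have hy := z.im_pos
    have hn : 0 < ‖(z : ℂ)‖ := norm_pos_iff.2 z.ne_zero
    have hcosh : Real.cosh (Real.arsinh (z.re / z.im)) = ‖(z : ℂ)‖ / z.im := by
      rw [Real.cosh_arsinh, Real.sqrt_eq_iff_eq_sq (by positivity) (by positivity), div_pow, div_pow,
        ← Complex.normSq_eq_norm_sq, Complex.normSq_apply, coe_re, coe_im]
      field_simp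
      ring
    refine ext_re_im ?_ ?_
    · rw [fermi_re, hcosh, Real.sinh_arsinh, Real.exp_log hn]
      field_simp
    · rw [fermi_im, hcosh, Real.exp_log hn]
      field_simp
  · have : (fermi (0, 0) : ℂ) = Complex.I := by
      apply Complex.ext <;> simp [fermi]
    simp only [this, fermi_re]
    simp

/-- A complete hyperbolic surface admits a local isometry from the hyperbolic plane. -/
theorem exists_developing_map (hS : IsHyperbolicSurface S) (hcomp : GeodesicallyComplete S)
    (s : S) : ∃ p : ℍ → S, (∀ z, IsEtaleAt p z) ∧ s ∈ range p := by
  obtain ⟨P₀, hP₀s, hP₀⟩ := exists_isEtaleAt hS s (fermi (0, 0))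
  obtain ⟨Q₀, hQ₀, hQ₀0⟩ := exists_continuation_along_geodesic hS hcomp isometry_fermi_axis hP₀
  obtain ⟨Q, hQ, hQ0⟩ := exists_continuation_along_family hS hcomp continuous_fermi isometry_fermi
    hQ₀
  obtain ⟨k, hk, hkf, hk0⟩ := exists_fermi_section
  let p : ℍ → S := fun z => Q (k z) z
  have hp : ∀ z, p =ᶠ[𝓝 z] Q (k z) := by
    intro z
    filter_upwards [hk.continuousAt.eventually (hQ (k z)).2] with z' hz'
    have := hz'.self_of_nhds
    rwa [hkf] at this
  refine ⟨p, fun z => ?_, ?_⟩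
  · have := (hQ (k z)).1
    rw [hkf] at this
    exact this.congr (hp z).symm
  · refine ⟨fermi (0, 0), ?_⟩
    simp only [p, hk0]
    rw [(hQ0 0).self_of_nhds, hQ₀0.self_of_nhds, hP₀s]

/-! ### Lipschitz bound and lifting of packings -/

/-- A local isometry from the hyperbolic plane does not increase distances. -/
lemma dist_map_le {p : ℍ → S} (hp : ∀ z, IsEtaleAt p z) (z w : ℍ) :
    dist (p z) (p w) ≤ dist z w := by
  obtain ⟨c, hc, h0, hL⟩ := exists_geodesic z w
  have hpc : Continuous p := continuous_iff_continuousAt.2 fun z => (hp z).continuousAt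
  have hcc := hc.continuous
  have hcl : IsClosed {t : ℝ | dist (p z) (p (c t)) ≤ t} :=
    isClosed_le (by fun_prop) continuous_id
  -- Continuous induction along the geodesic: the bound is a closed condition, and the isometry ball
  -- at `c t` pushes it beyond t.
  have := (hcl.inter (isClosed_Icc (a := 0) (b := dist z w))).Icc_subset_of_forall_exists_gt
    (by simp [h0]) (fun t ht u hu => ?_)
  · have := this ⟨dist_nonneg, le_rfl⟩
    rwa [mem_ofPred_eq, hL] at this
  · obtain ⟨r, hr, hr1⟩ := hp (c t)
    have ht1 : dist (p z) (p (c t)) ≤ t := ht.1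
    have hu' : t < u := hu
    set t' := min u (t + r / 2) with ht'
    have h1 : t < t' := lt_min hu' (by linarith)
    have h2 : t' ≤ t + r / 2 := min_le_right _ _
    have hd : dist (c t) (c t') = t' - t := by
      rw [hc.dist_eq, dist_comm, Real.dist_eq, abs_of_pos (by linarith)]
    refine ⟨t', ?_, h1, min_le_left _ _⟩
    have h3 : dist (p (c t)) (p (c t')) = dist (c t) (c t') :=
      hr1.1 _ (mem_ball_self hr) _ (by rw [mem_ball, dist_comm, hd]; linarith)
    have := dist_triangle (p z) (p (c t)) (p (c t'))
    rw [mem_ofPred_eq]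
    linarith

lemma exists_uniform_isIsometryOnBall {p : ℍ → S} (hp : ∀ z, IsEtaleAt p z) {K : Set ℍ}
    (hK : IsCompact K) : ∃ r > 0, ∀ z ∈ K, IsIsometryOnBall p z r := by
  refine hK.induction_on (p := fun K => ∃ r > 0, ∀ z ∈ K, IsIsometryOnBall p z r)
    ⟨1, one_pos, by simp⟩ (fun s t hst ⟨r, hr, h⟩ => ⟨r, hr, fun z hz => h z (hst hz)⟩)
    (fun s t ⟨r, hr, h⟩ ⟨r', hr', h'⟩ => ⟨min r r', lt_min hr hr', ?_⟩) (fun z _ => ?_)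
  · rintro z (hz | hz)
    · exact (h z hz).mono (lt_min hr hr') (by simp)
    · exact (h' z hz).mono (lt_min hr hr') (by simp)
  · obtain ⟨r, hr, h⟩ := hp z
    refine ⟨ball z (r / 2), mem_nhdsWithin_of_mem_nhds (ball_mem_nhds z (half_pos hr)), r / 2,
      half_pos hr, fun w hw => h.mono (half_pos hr) ?_⟩
    have := mem_ball.1 hw
    linarith

/-- Paths lift through a local isometry from the hyperbolic plane, without increase of length. -/
lemma exists_lift_of_dist_lt (hS : IsHyperbolicSurface S) {p : ℍ → S} (hp : ∀ z, IsEtaleAt p z)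
    (o : ℍ) {R : ℝ} {y : S} (hy : dist (p o) y < R) : ∃ z, dist o z ≤ R ∧ p z = y := by
  have hR : 0 < R := dist_nonneg.trans_lt hy
  obtain ⟨r, hr, hiso⟩ := exists_uniform_isIsometryOnBall hp (isCompact_closedBall o R)
  have hlt : edist (p o) y < ENNReal.ofReal R := by
    rw [edist_dist]; exact (ENNReal.ofReal_lt_ofReal_iff hR).2 hy
  rw [hS.edist_eq_iInf_pathLength, iInf_lt_iff] at hlt
  obtain ⟨γ, hγ⟩ := hlt
  have huc := CompactSpace.uniformContinuous_of_continuous γ.continuous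
  obtain ⟨δ, hδ, hγδ⟩ := Metric.uniformContinuous_iff.1 huc r hr
  obtain ⟨n, hn⟩ := exists_nat_one_div_lt hδ
  let t : ℕ → unitInterval := fun i => projIcc 0 1 zero_le_one (i / (n + 1 : ℝ))
  have hn0 : (0 : ℝ) < n + 1 := by positivity
  have htm : Monotone t := fun i j hij => monotone_projIcc _ (by gcongr)
  have hstep : ∀ i, dist (t (i + 1)) (t i) < δ := fun i => by
    refine lt_of_le_of_lt ?_ hn
    rw [Subtype.dist_eq, Real.dist_eq]
    refine (abs_projIcc_sub_projIcc zero_le_one).trans (le_of_eq ?_)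
    rw [← sub_div, Nat.cast_add_one, add_sub_cancel_left, abs_of_pos (by positivity)]
  have hsum : ∀ m, ∑ i ∈ Finset.range m, dist (γ (t (i + 1))) (γ (t i)) ≤ R := by
    intro m
    have h1 := (eVariationOn.sum_le (f := γ) (s := univ) (n := m) htm
      (fun i => mem_univ (t i))).trans hγ.le
    simp only [edist_dist] at h1
    rw [← ENNReal.ofReal_sum_of_nonneg (fun _ _ => dist_nonneg)] at h1
    -- Inscribed polygons are no longer than the path, which keeps every lifted vertex in the
    -- compact ball where the radius r is valid.
    exact (ENNReal.ofReal_le_ofReal_iff hR.le).1 h1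
  have hlift : ∀ m, ∃ z, p z = γ (t m) ∧
      dist o z ≤ ∑ i ∈ Finset.range m, dist (γ (t (i + 1))) (γ (t i)) := by
    intro m
    induction m with
    | zero => exact ⟨o, by simp [t], by simp⟩
    | succ m ih =>
      obtain ⟨z, hz, hzd⟩ := ih
      have hzR : z ∈ closedBall o R := by
        rw [mem_closedBall, dist_comm]; exact hzd.trans (hsum m)
      have him := (hiso z hzR).2
      have hmem : γ (t (m + 1)) ∈ ball (p z) r := by
        rw [mem_ball, hz]; exact hγδ (hstep m)
      rw [← him] at hmem
      obtain ⟨w, hw, hwe⟩ := hmem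
      refine ⟨w, hwe, ?_⟩
      rw [Finset.sum_range_succ]
      refine (dist_triangle o z w).trans (add_le_add hzd ?_)
      rw [← hwe, ← hz, (hiso z hzR).1 w hw z (mem_ball_self hr), dist_comm]
  obtain ⟨z, hz, hzd⟩ := hlift (n + 1)
  refine ⟨z, hzd.trans (hsum _), ?_⟩
  rw [hz]
  have : t (n + 1) = 1 := by
    simp only [t]
    rw [projIcc_of_right_le]
    · rfl
    · push_cast; rw [div_self hn0.ne']
  rw [this, γ.target]

/-- Separated finite subsets of balls of a complete hyperbolic surface lift to separated subsets of
balls of the same radius in the hyperbolic plane. -/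
lemma exists_lift_finset (hS : IsHyperbolicSurface S) (hcomp : GeodesicallyComplete S) {x : S}
    {R ε : ℝ} (F : Finset S) (hF : ∀ y ∈ F, dist x y < R)
    (hsep : ∀ y ∈ F, ∀ y' ∈ F, y ≠ y' → ε ≤ dist y y') :
    ∃ (o : ℍ) (F' : Finset ℍ), F'.card = F.card ∧ (∀ z ∈ F', dist o z ≤ R) ∧
      ∀ z ∈ F', ∀ z' ∈ F', z ≠ z' → ε ≤ dist z z' := by
  classical
  obtain ⟨p, hp, o, rfl⟩ := exists_developing_map hS hcomp x
  have hl : ∀ y, ∃ z, y ∈ F → dist o z ≤ R ∧ p z = y := fun y => by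
    by_cases hy : y ∈ F
    · exact (exists_lift_of_dist_lt hS hp o (hF y hy)).imp fun z hz _ => hz
    · exact ⟨o, fun h => absurd h hy⟩
  choose l hl using hl
  refine ⟨o, F.image l, Finset.card_image_of_injOn fun y hy y' hy' h => ?_, ?_, ?_⟩
  · rw [← (hl y hy).2, ← (hl y' hy').2]
    exact congrArg p h
  · simp only [Finset.mem_image]
    rintro _ ⟨y, hy, rfl⟩
    exact (hl y hy).1
  · simp only [Finset.mem_image]
    rintro _ ⟨y, hy, rfl⟩ _ ⟨y', hy', rfl⟩ hne
    refine (hsep y hy y' hy' fun h => hne (by rw [h])).trans ?_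
    have := dist_map_le hp (l y) (l y')
    rwa [(hl y hy).2, (hl y' hy').2] at this

/-! ### Greedy colouring -/

/-- Along a well-order, each vertex takes the least colour not used by its earlier neighbours. If N
+ 1 colours were all blocked, there would be N + 1 distinct neighbours. -/
lemma colorable_of_neighbors_le {V : Type u} (G : SimpleGraph V) (N : ℕ)
    (h : ∀ (v : V) (F : Finset V), (∀ u ∈ F, G.Adj u v) → F.card ≤ N) : G.Colorable (N + 1) := by
  classical
  have wf : WellFounded (WellOrderingRel : V → V → Prop) := IsWellFounded.wf
  let c : V → ℕ := wf.fix fun v ih =>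
    sInf {n | ∀ u (hu : WellOrderingRel u v), G.Adj u v → ih u hu ≠ n}
  have hc : ∀ v, c v = sInf {n | ∀ u, WellOrderingRel u v → G.Adj u v → c u ≠ n} := fun v =>
    wf.fix_eq _ v
  have hex : ∀ v, ∃ n < N + 1, ∀ u, WellOrderingRel u v → G.Adj u v → c u ≠ n := by
    intro v
    have : Nonempty V := ⟨v⟩
    by_contra! hcon
    choose! f hf1 hf2 hf3 using hcon
    have hcard : ((Finset.range (N + 1)).image f).card = N + 1 := by
      rw [Finset.card_image_of_injOn, Finset.card_range]
      intro a ha b hb hab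
      rw [← hf3 a (by simpa using ha), ← hf3 b (by simpa using hb), hab]
    have := h v ((Finset.range (N + 1)).image f) (by
      simp only [Finset.mem_image, Finset.mem_range]
      rintro _ ⟨n, hn, rfl⟩
      exact hf2 n hn)
    omega
  have hmem : ∀ v, ∀ u, WellOrderingRel u v → G.Adj u v → c u ≠ c v := by
    intro v
    obtain ⟨n, -, hn⟩ := hex v
    have := Nat.sInf_mem (s := {n | ∀ u, WellOrderingRel u v → G.Adj u v → c u ≠ n}) ⟨n, hn⟩
    rw [← hc v] at this
    exact this
  have hlt : ∀ v, c v < N + 1 := by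
    intro v
    obtain ⟨n, hn, hn'⟩ := hex v
    rw [hc v]
    exact lt_of_le_of_lt (Nat.sInf_le hn') hn
  refine ⟨SimpleGraph.Coloring.mk (fun v => ⟨c v, hlt v⟩) fun {u v} huv => ?_⟩
  intro he
  have he : c u = c v := by simpa using he
  rcases trichotomous_of WellOrderingRel u v with h1 | h1 | h1
  · exact hmem v u h1 huv he
  · exact huv.ne h1
  · exact hmem u v h1 huv.symm he.symm

/-! ### Areas of hyperbolic balls and packing -/

/-- The ball is a Euclidean disc of radius `z.im * sinh ρ`, on which the density 1/y² is at least
`(z.im * exp ρ)⁻²`. -/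
lemma volume_ball_ge (z : ℍ) {ρ : ℝ} (hρ : 0 < ρ) :
    ENNReal.ofReal (Real.pi * (Real.sinh ρ / Real.exp ρ) ^ 2) ≤ volume (ball z ρ) := by
  have hy := z.im_pos
  have hs : 0 < Real.sinh ρ := Real.sinh_pos_iff.2 hρ
  rw [volume_eq_lintegral]
  have hlow : ∀ w ∈ (UpperHalfPlane.coe '' ball z ρ),
      ENNReal.ofReal ((1 / (z.im * Real.exp ρ)) ^ 2) ≤ ↑((1 / ‖w.im‖₊) ^ 2 : NNReal) := by
    rintro _ ⟨w, hw, rfl⟩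
    have h1 : w.im ≤ z.im * Real.exp ρ := (im_le_im_mul_exp_dist w z).trans (by
      have := mem_ball.1 hw
      gcongr)
    have hw := w.im_pos
    rw [ENNReal.ofReal, ENNReal.coe_le_coe, ← NNReal.coe_le_coe, Real.coe_toNNReal _ (by positivity)]
    simp only [NNReal.coe_pow, NNReal.coe_div, NNReal.coe_one, coe_nnnorm, coe_im, Real.norm_eq_abs,
      abs_of_pos hw]
    gcongr
  have hmeas : MeasurableSet (UpperHalfPlane.coe '' ball z ρ) :=
    measurableEmbedding_coe.measurableSet_image.2 isOpen_ball.measurableSet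
  calc ENNReal.ofReal (Real.pi * (Real.sinh ρ / Real.exp ρ) ^ 2)
      = ENNReal.ofReal ((1 / (z.im * Real.exp ρ)) ^ 2) * volume (UpperHalfPlane.coe '' ball z ρ) := by
        rw [image_coe_ball, Complex.volume_ball, ← ENNReal.ofReal_pow (by positivity),
          ← NNReal.coe_real_pi, ENNReal.ofReal_coe_nnreal.symm, ← ENNReal.ofReal_mul (by positivity),
          ← ENNReal.ofReal_mul (by positivity)]
        congr 1
        field_simp
    _ = ∫⁻ w in (UpperHalfPlane.coe '' ball z ρ), ENNReal.ofReal ((1 / (z.im * Real.exp ρ)) ^ 2) := by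
        rw [setLIntegral_const]
    _ ≤ _ := setLIntegral_mono' hmeas hlow

/-- The same disc with the upper density bound. It has the right order ρ² at small scales but grows
like e^{4ρ}, too fast for large ones. -/
lemma volume_ball_le_of_small {ρ : ℝ} (hρ : 0 < ρ) :
    volume (ball UpperHalfPlane.I ρ) ≤ ENNReal.ofReal (Real.pi * (Real.sinh ρ * Real.exp ρ) ^ 2) := by
  have hs : 0 < Real.sinh ρ := Real.sinh_pos_iff.2 hρ
  rw [volume_eq_lintegral]
  have hup : ∀ w ∈ (UpperHalfPlane.coe '' ball UpperHalfPlane.I ρ),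
      ↑((1 / ‖w.im‖₊) ^ 2 : NNReal) ≤ ENNReal.ofReal (Real.exp ρ ^ 2) := by
    rintro _ ⟨w, hw, rfl⟩
    have h1 : 1 ≤ w.im * Real.exp ρ := (im_le_im_mul_exp_dist UpperHalfPlane.I w).trans (by
      have := mem_ball'.1 hw
      have := w.im_pos
      gcongr)
    have hw := w.im_pos
    rw [ENNReal.ofReal, ENNReal.coe_le_coe, ← NNReal.coe_le_coe, Real.coe_toNNReal _ (by positivity)]
    simp only [NNReal.coe_pow, NNReal.coe_div, NNReal.coe_one, coe_nnnorm, coe_im, Real.norm_eq_abs,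
      abs_of_pos hw]
    gcongr
    rw [div_le_iff₀ hw]
    linarith
  have hmeas : MeasurableSet (UpperHalfPlane.coe '' ball UpperHalfPlane.I ρ) :=
    measurableEmbedding_coe.measurableSet_image.2 isOpen_ball.measurableSet
  refine (setLIntegral_mono' hmeas hup).trans (le_of_eq ?_)
  rw [setLIntegral_const, image_coe_ball, Complex.volume_ball, ← ENNReal.ofReal_pow (by simp; positivity),
    ← NNReal.coe_real_pi, ENNReal.ofReal_coe_nnreal.symm, ← ENNReal.ofReal_mul (by positivity),
    ← ENNReal.ofReal_mul (by positivity)]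
  congr 1
  simp only [I_im]
  ring

/-- From cosh(dist) ≤ e^R one gets x² ≤ 2e^R y − 1 − y². The resulting parabolic region is easy to
integrate over and still has area of order e^R. -/
lemma ball_I_subset {R : ℝ} (z : ℍ) (hz : z ∈ ball UpperHalfPlane.I R) :
    Real.exp (-R) < z.im ∧ |z.re| ≤ √(2 * Real.exp R) * √z.im := by
  have hy := z.im_pos
  have hd : dist UpperHalfPlane.I z < R := mem_ball'.1 hz
  have hR : 0 < R := dist_nonneg.trans_lt hd
  refine ⟨?_, ?_⟩
  · have h1 := im_le_im_mul_exp_dist UpperHalfPlane.I z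
    rw [I_im] at h1
    have h2 : z.im * Real.exp (dist UpperHalfPlane.I z) < z.im * Real.exp R := by gcongr
    rw [Real.exp_neg, inv_lt_iff_one_lt_mul₀ (Real.exp_pos _)]
    linarith
  · rw [← Real.sqrt_mul (by positivity)]
    refine Real.abs_le_sqrt ?_
    have h1 : Real.cosh (dist UpperHalfPlane.I z) ≤ Real.exp R := by
      have h3 : Real.cosh R ≤ Real.exp R := by
        rw [Real.cosh_eq]
        have := Real.exp_le_exp.2 (show -R ≤ R by linarith)
        linarith
      refine le_trans (Real.cosh_le_cosh.2 ?_) h3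
      rw [abs_of_nonneg dist_nonneg, abs_of_pos hR]
      exact hd.le
    rw [cosh_dist_eq_lorentz] at h1
    simp [lorentz, toHyp, -coe_re, -coe_im] at h1
    rw [← sub_nonneg] at h1 ⊢
    have h4 : 0 ≤ 2 * z.im * (Real.exp R - (z.im⁻¹ + (z.re ^ 2 + z.im ^ 2) / z.im) / 2) := by
      positivity
    have h5 : 2 * z.im * (Real.exp R - (z.im⁻¹ + (z.re ^ 2 + z.im ^ 2) / z.im) / 2) =
      2 * Real.exp R * z.im - z.re ^ 2 - (1 + z.im ^ 2) := by field_simp; ring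
    nlinarith [sq_nonneg z.im]

lemma volume_ball_le {R : ℝ} : volume (ball UpperHalfPlane.I R) ≤ ENNReal.ofReal (8 * Real.exp R) := by
  set a := Real.exp (-R) with ha
  have ha0 : 0 < a := Real.exp_pos _
  set B := √(2 * Real.exp R) with hB
  have hB0 : 0 < B := by positivity
  set T : Set ℂ := {w | a < w.im ∧ |w.re| ≤ B * √w.im}
  have hT : UpperHalfPlane.coe '' ball UpperHalfPlane.I R ⊆ T := by
    rintro _ ⟨w, hw, rfl⟩
    exact ball_I_subset w hw
  rw [volume_eq_lintegral]
  refine (lintegral_mono_set hT).trans ?_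
  let F : ℝ × ℝ → ENNReal := fun q =>
    (Ioi a).indicator (fun y => ENNReal.ofReal ((1 / y) ^ 2) *
      (Icc (-(B * √y)) (B * √y)).indicator 1 q.1) q.2
  have hmT : MeasurableSet T := by
    apply MeasurableSet.inter
    · exact measurableSet_lt measurable_const Complex.measurable_im
    · exact measurableSet_le (f := fun w : ℂ => |w.re|) (g := fun w : ℂ => B * √w.im)
        (by fun_prop) (by fun_prop)
  have hF : Measurable F := by
    have : F = {q : ℝ × ℝ | a < q.2 ∧ |q.1| ≤ B * √q.2}.indicator
        fun q => ENNReal.ofReal ((1 / q.2) ^ 2) := by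
      funext q
      simp only [F, indicator_apply, mem_Ioi, mem_Icc, ← abs_le, mem_ofPred_eq, Pi.one_apply]
      by_cases h1 : a < q.2 <;> by_cases h2 : |q.1| ≤ B * √q.2 <;> simp [h1, h2]
    rw [this]
    refine Measurable.indicator (by fun_prop) (MeasurableSet.inter ?_ ?_)
    · exact measurableSet_lt measurable_const measurable_snd
    · exact measurableSet_le (f := fun q : ℝ × ℝ => |q.1|) (g := fun q : ℝ × ℝ => B * √q.2)
        (by fun_prop) (by fun_prop)
  calc ∫⁻ z : ℂ in T, ↑((1 / ‖z.im‖₊) ^ 2 : NNReal)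
      = ∫⁻ z : ℂ, F (Complex.measurableEquivRealProd z) := by
        rw [← lintegral_indicator hmT]
        congr 1
        funext z
        simp only [F, T, indicator_apply, mem_Ioi, mem_Icc, ← abs_le, mem_ofPred_eq, Pi.one_apply,
          Complex.measurableEquivRealProd_apply]
        by_cases h1 : a < z.im <;> by_cases h2 : |z.re| ≤ B * √z.im <;> simp [h1, h2]
        congr 1
        ext
        rw [Real.coe_toNNReal _ (by positivity)]
        simp
    _ = ∫⁻ q, F q := Complex.volume_preserving_equiv_real_prod.lintegral_comp hF
    _ = ∫⁻ y, ∫⁻ x, F (x, y) := by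
        rw [Measure.volume_eq_prod, lintegral_prod_symm' _ hF]
    -- Horizontal slices have length 2B√y and density y⁻²; the integral is 4B·e^{R/2}, and B ≤
    -- 2e^{R/2} gives the constant 8.
    _ = ∫⁻ y in Ioi a, ENNReal.ofReal (2 * B * y ^ (-(3 / 2) : ℝ)) := by
        rw [← lintegral_indicator measurableSet_Ioi]
        congr 1
        funext y
        by_cases hy : y ∈ Ioi a
        · have hy0 : 0 < y := ha0.trans hy
          simp only [F, indicator_of_mem hy]
          rw [lintegral_const_mul _ (by fun_prop (disch := measurability)), lintegral_indicator_one measurableSet_Icc,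
            Real.volume_Icc, ← ENNReal.ofReal_mul (by positivity)]
          congr 1
          have : y ^ (-(3 / 2) : ℝ) = √y * (1 / y) ^ 2 := by
            rw [Real.sqrt_eq_rpow, one_div y, inv_pow, ← Real.rpow_natCast, ← Real.rpow_neg hy0.le,
              ← Real.rpow_add hy0]
            norm_num
          rw [this]; ring
        · simp only [F, indicator_of_notMem hy, lintegral_zero]
    _ = ENNReal.ofReal (∫ y in Ioi a, 2 * B * y ^ (-(3 / 2) : ℝ)) := by
        rw [ofReal_integral_eq_lintegral_ofReal]
        · exact (integrableOn_Ioi_rpow_of_lt (by norm_num) ha0).const_mul _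
        · filter_upwards [self_mem_ae_restrict measurableSet_Ioi] with y hy
          have : 0 < y := ha0.trans hy
          positivity
    _ ≤ _ := by
        apply ENNReal.ofReal_le_ofReal
        rw [integral_const_mul, integral_Ioi_rpow_of_lt (by norm_num) ha0]
        have h1 : a ^ (-(3 / 2) + 1 : ℝ) = Real.exp (R / 2) := by
          rw [ha, ← Real.exp_mul]; congr 1; ring
        have h2 : B ≤ 2 * Real.exp (R / 2) := by
          rw [hB, Real.sqrt_le_left (by positivity), mul_pow, ← Real.exp_nat_mul]
          have : ((2 : ℕ) : ℝ) * (R / 2) = R := by push_cast; ring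
          rw [this]
          have := Real.exp_pos R
          linarith
        have h3 : Real.exp (R / 2) * Real.exp (R / 2) = Real.exp R := by
          rw [← Real.exp_add]; congr 1; ring
        rw [h1]
        have := Real.exp_pos (R / 2)
        have h4 : -Real.exp (R / 2) / (-(3 / 2) + 1) = 2 * Real.exp (R / 2) := by ring
        rw [h4]
        nlinarith

/-- The balls of radius ε/2 about the points are disjoint and lie in one of radius R + ε, which an
isometry recentres at `I`. -/
lemma card_mul_volume_le {F : Finset ℍ} {o : ℍ} {R ε v V : ℝ} (hε : 0 < ε)
    (hF : ∀ z ∈ F, dist o z ≤ R) (hsep : ∀ z ∈ F, ∀ z' ∈ F, z ≠ z' → ε ≤ dist z z')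
    (hv : ∀ z : ℍ, ENNReal.ofReal v ≤ volume (ball z (ε / 2)))
    (hV : volume (ball UpperHalfPlane.I (R + ε)) ≤ ENNReal.ofReal V) (hV0 : 0 ≤ V) :
    F.card * v ≤ V := by
  classical
  obtain ⟨g, hg⟩ := exists_isometryEquiv_apply_eq o UpperHalfPlane.I
  have hdisj : (F : Set ℍ).PairwiseDisjoint fun z => ball (g z) (ε / 2) := by
    intro z hz z' hz' hne
    refine ball_disjoint_ball ?_
    rw [g.isometry.dist_eq]
    have := hsep z hz z' hz' hne
    linarith
  have hsub : (⋃ z ∈ F, ball (g z) (ε / 2)) ⊆ ball UpperHalfPlane.I (R + ε) := by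
    refine iUnion₂_subset fun z hz => ball_subset_ball' ?_
    rw [← hg, g.isometry.dist_eq, dist_comm]
    have := hF z hz
    linarith
  have h1 := (measure_mono hsub).trans hV
  rw [measure_biUnion_finset hdisj fun z _ => isOpen_ball.measurableSet] at h1
  have h2 : (F.card : ENNReal) * ENNReal.ofReal v ≤ ENNReal.ofReal V := by
    refine le_trans ?_ h1
    rw [← nsmul_eq_mul]
    exact Finset.card_nsmul_le_sum _ _ _ fun z _ => hv (g z)
  rw [← ENNReal.ofReal_natCast, ← ENNReal.ofReal_mul (by positivity),
    ENNReal.ofReal_le_ofReal_iff hV0] at h2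
  exact h2

lemma sinh_le_mul_exp {x : ℝ} : Real.sinh x ≤ x * Real.exp x := by
  have h1 := Real.add_one_le_exp (-(2 * x))
  have h2 : Real.exp (-x) = Real.exp x * Real.exp (-(2 * x)) := by
    rw [← Real.exp_add]; congr 1; ring
  rw [Real.sinh_eq, h2]
  nlinarith [Real.exp_pos x]

/-- A packing bound in the hyperbolic plane, uniform over all scales. -/
lemma exists_packing_bound : ∃ C : ℝ, 0 < C ∧ ∀ d : ℝ, 0 < d → ∀ (o : ℍ) (F : Finset ℍ),
    (∀ z ∈ F, dist o z ≤ d + 3 * (min d 1 / 4)) →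
    (∀ z ∈ F, ∀ z' ∈ F, z ≠ z' → min d 1 / 4 ≤ dist z z') → F.card ≤ C * Real.exp d := by
  set v₁ := Real.pi * (Real.sinh (1 / 8) / Real.exp (1 / 8)) ^ 2 with hv₁
  have hv₁0 : 0 < v₁ := by
    have : 0 < Real.sinh (1 / 8) := Real.sinh_pos_iff.2 (by norm_num)
    positivity
  have hexp := Real.exp_pos
  refine ⟨max (8 * Real.exp 1 / v₁) ((16 * Real.exp 5) ^ 2), by positivity,
    fun d hd o F hF hsep => ?_⟩
  -- With ε = `min d 1 / 4`, the enclosing radius d + 4ε is d + 1 or 2d, and the small radius ε/2 is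
  -- 1/8 or d/8.
  rcases le_total 1 d with h1 | h1
  · rw [min_eq_right h1] at hF hsep
    have := card_mul_volume_le (v := v₁) (V := 8 * Real.exp (d + 1)) (by norm_num) hF hsep
      (fun z => by
        have := volume_ball_ge z (ρ := 1 / 8) (by norm_num)
        norm_num at this ⊢
        simpa [hv₁] using this)
      (by
        have := volume_ball_le (R := d + 1)
        convert this using 3
        ring) (by positivity)
    rw [← le_div_iff₀ hv₁0] at this
    refine this.trans ?_
    rw [Real.exp_add]
    calc 8 * (Real.exp d * Real.exp 1) / v₁ = 8 * Real.exp 1 / v₁ * Real.exp d := by ring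
      _ ≤ _ := by gcongr; exact le_max_left _ _
  · rw [min_eq_left h1] at hF hsep
    have hd8 : 0 < d / 8 := by linarith
    have hs8 : d / 8 ≤ Real.sinh (d / 8) := Real.self_le_sinh_iff.2 hd8.le
    have hs0 : 0 < Real.sinh (d / 8) := hd8.trans_le hs8
    have hs2 : Real.sinh (2 * d) ≤ 2 * d * Real.exp (2 * d) := sinh_le_mul_exp
    have hs20 : 0 < Real.sinh (2 * d) := Real.sinh_pos_iff.2 (by linarith)
    have := card_mul_volume_le (v := Real.pi * (Real.sinh (d / 8) / Real.exp (d / 8)) ^ 2)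
      (V := Real.pi * (Real.sinh (2 * d) * Real.exp (2 * d)) ^ 2) (by linarith) hF hsep
      (fun z => by
        have := volume_ball_ge z (ρ := d / 8) hd8
        convert this using 3
        ring)
      (by
        have := volume_ball_le_of_small (ρ := 2 * d) (by linarith)
        convert this using 3
        ring) (by positivity)
    -- Here sinh(2d) ≤ 2d·e^{2d} and d/8 ≤ sinh(d/8), whence 16; the exponentials multiply to
    -- e^{33d/8} ≤ e⁵.
    have h2 : Real.sinh (2 * d) * Real.exp (2 * d) ≤
        16 * Real.exp 5 * (Real.sinh (d / 8) / Real.exp (d / 8)) := by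
      have e1 : Real.exp (2 * d) * Real.exp (2 * d) * Real.exp (d / 8) ≤ Real.exp 5 := by
        rw [← Real.exp_add, ← Real.exp_add]
        exact Real.exp_le_exp.2 (by linarith)
      rw [← mul_div_assoc, le_div_iff₀ (hexp _)]
      calc Real.sinh (2 * d) * Real.exp (2 * d) * Real.exp (d / 8)
          ≤ 2 * d * Real.exp (2 * d) * Real.exp (2 * d) * Real.exp (d / 8) := by gcongr
        _ = 2 * d * (Real.exp (2 * d) * Real.exp (2 * d) * Real.exp (d / 8)) := by ring
        _ ≤ 2 * d * Real.exp 5 := by gcongr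
        _ = 16 * Real.exp 5 * (d / 8) := by ring
        _ ≤ _ := by gcongr
    have h3 : (F.card : ℝ) ≤ (16 * Real.exp 5) ^ 2 := by
      set q := Real.sinh (d / 8) / Real.exp (d / 8)
      have hq : 0 < q := by positivity
      have h4 : (F.card : ℝ) * (Real.pi * q ^ 2) ≤ (16 * Real.exp 5) ^ 2 * (Real.pi * q ^ 2) :=
        this.trans (by
          calc Real.pi * (Real.sinh (2 * d) * Real.exp (2 * d)) ^ 2
              ≤ Real.pi * (16 * Real.exp 5 * q) ^ 2 := by gcongr
            _ = _ := by ring)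
      exact le_of_mul_le_mul_right h4 (by positivity)
    calc (F.card : ℝ) ≤ (16 * Real.exp 5) ^ 2 * 1 := by rw [mul_one]; exact h3
      _ ≤ _ := by
        gcongr
        · exact le_max_right _ _
        · exact Real.one_le_exp hd.le

/-! ### From nets to colourings -/

/-- Every metric space has an `ε`-separated `ε`-net. -/
lemma exists_separated_net (X : Type u) [MetricSpace X] {ε : ℝ} (hε : 0 < ε) :
    ∃ A : Set X, (∀ a ∈ A, ∀ b ∈ A, a ≠ b → ε ≤ dist a b) ∧ ∀ x, ∃ a ∈ A, dist x a < ε := by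
  obtain ⟨A, hA⟩ := zorn_subset {A : Set X | A.Pairwise fun a b => ε ≤ dist a b}
    fun c hc hchain => ⟨⋃₀ c, (pairwise_sUnion hchain.directedOn).2 fun s hs => hc hs,
      fun s hs => subset_sUnion_of_mem hs⟩
  refine ⟨A, fun a ha b hb hab => hA.prop ha hb hab, fun x => ?_⟩
  by_contra! hx
  have hins : (insert x A).Pairwise fun a b => ε ≤ dist a b :=
    hA.prop.insert fun b hb _ => ⟨hx b hb, by rw [dist_comm]; exact hx b hb⟩
  have hxA : x ∈ A := hA.le_of_ge hins (subset_insert x A) (mem_insert x A)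
  have := hx x hxA
  rw [dist_self] at this
  linarith

/-- A coloring of the proximity graph of a fine net induces a coloring of the space. -/
lemma distanceGraph_colorable {X : Type u} [MetricSpace X] {d ε : ℝ} (hd : 2 * ε ≤ d)
    (hε : 0 < ε) {N : ℕ} (hN : ∀ (F : Finset X) (x : X), (∀ y ∈ F, dist x y < d + 3 * ε) →
      (∀ y ∈ F, ∀ y' ∈ F, y ≠ y' → ε ≤ dist y y') → F.card ≤ N) :
    (distanceGraph X d).Colorable (N + 1) := by
  obtain ⟨A, hsep, hnet⟩ := exists_separated_net X hε
  let G : SimpleGraph A :=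
    { Adj := fun a b => a ≠ b ∧ dist a b < d + 3 * ε
      symm := ⟨fun a b h => ⟨h.1.symm, by rw [dist_comm]; exact h.2⟩⟩
      loopless := ⟨fun _ h => h.1 rfl⟩ }
  have hG : G.Colorable (N + 1) := colorable_of_neighbors_le G N fun a F hF => by
    rw [← Finset.card_map (Function.Embedding.subtype (· ∈ A))]
    refine hN _ (a : X) ?_ ?_
    · simp only [Finset.mem_map]
      rintro _ ⟨b, hb, rfl⟩
      rw [dist_comm]
      exact (hF b hb).2
    · simp only [Finset.mem_map]
      rintro _ ⟨b, -, rfl⟩ _ ⟨b', -, rfl⟩ hne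
      exact hsep _ b.2 _ b'.2 hne
  obtain ⟨col⟩ := hG
  choose π hπA hπ using hnet
  -- Points sharing a net point are less than 2ε ≤ d apart. Otherwise the net points are within d +
  -- 2ε; the third ε is slack.
  refine ⟨SimpleGraph.Coloring.mk (fun x => col ⟨π x, hπA x⟩) fun {x y} hxy => col.valid ⟨?_, ?_⟩⟩
  · intro h
    have h : π x = π y := congrArg Subtype.val h
    have h1 := hπ x
    have h2 := hπ y
    rw [← h] at h2
    have := dist_triangle_right x y (π x)
    have := hxy.2
    linarith
  · have h1 := hπ x
    have h2 := hπ y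
    rw [Subtype.dist_eq]
    have h3 := dist_triangle4 (π x) x y (π y)
    have := hxy.2
    rw [dist_comm (π x) x] at h3
    linarith

end HyperbolicSurface

theorem theorem1p1 :
    ∃ C₁ : ℝ, 0 < C₁ ∧ ∀ d : ℝ, 0 < d →
      ∀ (S : Type u) [MetricSpace S], IsHyperbolicSurface S → GeodesicallyComplete S →
        (dChromaticNumber S d : ENNReal) ≤ ENNReal.ofReal (C₁ * Real.exp d) := by
  obtain ⟨C, hC, hpack⟩ := HyperbolicSurface.exists_packing_bound
  -- The extra 1 absorbs the additional greedy colour, since 1 ≤ e^d.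
  refine ⟨C + 1, by linarith, fun d hd S _ hS hcomp => ?_⟩
  have hε : 0 < min d 1 / 4 := by positivity
  have hεd : 2 * (min d 1 / 4) ≤ d := by
    have := min_le_left d 1
    linarith
  have hcol := HyperbolicSurface.distanceGraph_colorable (X := S) hεd hε
    (N := ⌊C * Real.exp d⌋₊) fun F x hF hsep => by
      obtain ⟨o, F', hcard, hF', hsep'⟩ :=
        HyperbolicSurface.exists_lift_finset hS hcomp F hF hsep
      rw [← hcard]
      exact Nat.le_floor (hpack d hd o F' hF' hsep')
  have h1 : dChromaticNumber S d ≤ ((⌊C * Real.exp d⌋₊ + 1 : ℕ) : ℕ∞) := hcol.chromaticNumber_le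
  have h2 : (dChromaticNumber S d : ENNReal) ≤ ((⌊C * Real.exp d⌋₊ + 1 : ℕ) : ENNReal) := by
    exact_mod_cast ENat.toENNReal_le.2 h1
  refine h2.trans ?_
  rw [← ENNReal.ofReal_natCast]
  apply ENNReal.ofReal_le_ofReal
  push_cast
  have h3 := Nat.floor_le (show 0 ≤ C * Real.exp d by positivity)
  have h4 := Real.one_le_exp hd.le
  linarith
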